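/- Let $\mathfrak{sl}_2$ be the complex Lie algebra with basis $e,h,f$ and $[e,f]=h$, $[h,e]=2e$, $[h,f]=-2f$, let $\mathfrak g=\mathfrak{sl}_2\otimes_{\mathbb C}\mathbb C[x]/(x^2)$ be its Takiff Lie algebra, with bracket $[a\otimes x^i,b\otimes x^j]=[a,b]\otimes x^{i+j}$, and write $\overline a=a\otimes x$ for $a\in\mathfrak{sl}_2$. Let $\overline{\mathfrak h}$ be the span of $h,\overline h$, let $\overline{\mathfrak n}_+$ be the span of $e,\overline e$, put $\overline{\mathfrak b}=\overline{\mathfrak h}\oplus\overline{\mathfrak n}_+$, and let $\alpha\in\overline{\mathfrak h}^*$ be given by $\alpha(h)=2$, $\alpha(\overline h)=0$. Let $\mathcal O$ be the full subcategory of the category of $\mathfrak g$-modules consisting of the finitely generated modules on which $U(\overline{\mathfrak b})$ acts locally finitely and $h$ acts diagonalizably. The support of $M\in\mathcal O$ is the set of those $\mu\in\overline{\mathfrak h}^*$ for which some non-zero vector of $M$ is killed by powers of $h-\mu(h)$ and of $\overline h-\mu(\overline h)$. For $\xi\subseteq\overline{\mathfrak h}^*$ let $\mathcal O(\xi)$ be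 the full subcategory of $\mathcal O$ of the modules with support contained in $\xi$. For $\lambda\in\overline{\mathfrak h}^*$ let $L(\lambda)$ be the simple quotient of the Verma module $\Delta(\lambda)=U(\mathfrak g)\otimes_{U(\overline{\mathfrak b})}\mathbb C_\lambda$, where $\overline{\mathfrak n}_+$ acts on $\mathbb C_\lambda$ by zero. The Gabriel quiver of $\mathcal O(\xi)$ has as vertices the isomorphism classes of simple objects of $\mathcal O(\xi)$, and the number of arrows from $L$ to $S$ is $\dim\mathrm{Ext}^1(L,S)$, computed in $\mathcal O(\xi)$. Assume that $\lambda\in\overline{\mathfrak h}^*$ satisfies $\lambda(\overline h)=0$ and $\lambda(h)\notin\mathbb Z$, and put $\xi=\lambda+\mathbb Z\alpha$. Then the modules $L(\lambda+k\alpha)$, $k\in\mathbb Z$, form a complete and irredundant list of the simple objects of $\mathcal O(\xi)$ up to isomorphism, and the Gabriel quiver of $\mathcal O(\xi)$ is the infinite line in which, for all $k,l\in\mathbb Z$, there is exactly one arrow from $L(\lambda+k\alpha)$ to $L(\lambda+l\alpha)$ if $l\in\{k,k+1,k-1\}$, and none otherwise: one loop at each vertex and one arrow in each direction between neighbours. Moreover,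 for $\mu\in\lambda+\mathbb Z\alpha$, the space $\mathrm{Ext}^1_{\mathcal O}(L(\lambda),L(\mu))$ has dimension $1$ if $\mu\in\{\lambda,\lambda+\alpha,\lambda-\alpha\}$ and dimension $0$ otherwise. -/

import Mathlib

open scoped TensorProduct

noncomputable section

namespace Takiff

/-! ### The Takiff Lie algebra of `sl₂` -/

/-- The complex Lie algebra of traceless `2 × 2` matrices. -/
abbrev Sl2 : Type := LieAlgebra.SpecialLinear.sl (Fin 2) ℂ

/-- The standard basis element `e` of `sl₂`. -/
def sl2E : Sl2 := ⟨!![0, 1; 0, 0], by simp [LieAlgebra.SpecialLinear.sl]⟩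

/-- The standard basis element `h` of `sl₂`. -/
def sl2H : Sl2 := ⟨!![1, 0; 0, -1], by simp [LieAlgebra.SpecialLinear.sl]⟩

/-- The standard basis element `f` of `sl₂`. -/
def sl2F : Sl2 := ⟨!![0, 0; 1, 0], by simp [LieAlgebra.SpecialLinear.sl]⟩

/-- The Takiff Lie algebra `𝔤 = ℂ[x]/(x²) ⊗ sl₂`, a complex Lie algebra with bracket
`[s ⊗ a, t ⊗ b] = (s t) ⊗ [a, b]`. -/
abbrev G : Type := DualNumber ℂ ⊗[ℂ] Sl2

/-- `e ∈ 𝔤`. -/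
def e : G := (1 : DualNumber ℂ) ⊗ₜ[ℂ] sl2E
/-- `h ∈ 𝔤`. -/
def h : G := (1 : DualNumber ℂ) ⊗ₜ[ℂ] sl2H
/-- `f ∈ 𝔤`. -/
def f : G := (1 : DualNumber ℂ) ⊗ₜ[ℂ] sl2F
/-- `ē = e ⊗ x ∈ 𝔤`. -/
def ebar : G := (DualNumber.eps : DualNumber ℂ) ⊗ₜ[ℂ] sl2E
/-- `h̄ = h ⊗ x ∈ 𝔤`. -/
def hbar : G := (DualNumber.eps : DualNumber ℂ) ⊗ₜ[ℂ] sl2H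
/-- `f̄ = f ⊗ x ∈ 𝔤`. -/
def fbar : G := (DualNumber.eps : DualNumber ℂ) ⊗ₜ[ℂ] sl2F

/-- The Cartan subalgebra of `𝔤`, generated by `h` and `h̄`. -/
def cartan : LieSubalgebra ℂ G := LieSubalgebra.lieSpan ℂ G {h, hbar}

/-- The Borel subalgebra of `𝔤`, generated by `h`, `h̄`, `e` and `ē`. -/
def borel : LieSubalgebra ℂ G := LieSubalgebra.lieSpan ℂ G {h, hbar, e, ebar}

/-- `h` as an element of the Cartan subalgebra. -/
def cartanH : cartan := ⟨h, LieSubalgebra.subset_lieSpan (by simp)⟩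

/-- `h̄` as an element of the Cartan subalgebra. -/
def cartanHbar : cartan := ⟨hbar, LieSubalgebra.subset_lieSpan (by simp)⟩

/-- Weights: linear functionals on the Cartan subalgebra. -/
abbrev Weight : Type := Module.Dual ℂ cartan

/-- The functional `A ↦ A₀₀ - A₁₁` on `sl₂`. -/
def diagDiff : Sl2 →ₗ[ℂ] ℂ where
  toFun A := A.1 0 0 - A.1 1 1
  map_add' A B := by simp; ring
  map_smul' c A := by simp; ring

/-- The functional `(s + t x) ⊗ A ↦ s (A₀₀ - A₁₁)` on `𝔤`. -/
def alphaFull : G →ₗ[ℂ] ℂ :=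
  LinearMap.mul' ℂ ℂ ∘ₗ
    TensorProduct.map (TrivSqZeroExt.fstHom ℂ ℂ ℂ).toLinearMap diagDiff

/-- The weight `α`, with `α(h) = 2` and `α(h̄) = 0`. -/
def alpha : Weight := alphaFull ∘ₗ cartan.toSubmodule.subtype

theorem alpha_h : alpha cartanH = 2 := by
  change alphaFull h = 2
  simp [alphaFull, h, diagDiff, sl2H]
  norm_num

theorem alpha_hbar : alpha cartanHbar = 0 := by
  change alphaFull hbar = 0
  simp [alphaFull, hbar]

/-! ### Modules -/

/-- The universal enveloping algebra of `𝔤`. -/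
abbrev U : Type := UniversalEnvelopingAlgebra ℂ G

/-- The canonical map from `𝔤` to `U(𝔤)`. -/
abbrev inc (x : G) : U := UniversalEnvelopingAlgebra.ι ℂ x

/-- A `𝔤`-module, that is, a left module over `U(𝔤)`, with its underlying complex vector space. -/
structure GMod where
  /-- The underlying type. -/
  carrier : Type
  [addCommGroup : AddCommGroup carrier]
  [moduleC : Module ℂ carrier]
  [moduleU : Module U carrier]
  [tower : IsScalarTower ℂ U carrier]

instance : CoeSort GMod Type := ⟨GMod.carrier⟩

attribute [instance] GMod.addCommGroup GMod.moduleC GMod.moduleU GMod.tower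

/-- The operator by which `x ∈ 𝔤` acts on a `𝔤`-module. -/
def op (M : GMod) (x : G) : Module.End ℂ M := Algebra.lsmul ℂ ℂ M (inc x)

theorem op_apply (M : GMod) (x : G) (m : M) : op M x m = inc x • m := rfl

/-- The generalized weight space `M^μ`: the vectors that are killed by some power of `h - μ(h)`
and by some power of `h̄ - μ(h̄)`. As these two operators commute and generate the maximal ideal
of `ℂ[h, h̄]` at `μ`, this is the set of vectors killed by some power of that ideal. -/
def weightSpace (M : GMod) (μ : Weight) : Submodule ℂ M :=
  (op M h).maxGenEigenspace (μ cartanH) ⊓ (op M hbar).maxGenEigenspace (μ cartanHbar)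

/-- The support of a module. -/
def support (M : GMod) : Set Weight := {μ | weightSpace M μ ≠ ⊥}

/-- The action of the Borel subalgebra is locally finite: every vector lies in a finite
dimensional subspace that is stable under the Borel subalgebra. -/
def BorelLocallyFinite (M : GMod) : Prop :=
  ∀ m : M, ∃ W : Submodule ℂ M, FiniteDimensional ℂ W ∧ m ∈ W ∧
    ∀ x ∈ borel, ∀ w ∈ W, inc x • w ∈ W

/-- The action of `h` is diagonalizable. -/
def HDiagonalizable (M : GMod) : Prop := ⨆ c : ℂ, (op M h).eigenspace c = ⊤

/-- The thick category `𝒪`: finitely generated `𝔤`-modules on which the Borel subalgebra acts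
locally finitely. -/
def ThickO (M : GMod) : Prop := Module.Finite U M ∧ BorelLocallyFinite M

/-- The category `𝒪`: the modules of thick category `𝒪` that are weight modules. -/
def CatO (M : GMod) : Prop := ThickO M ∧ HDiagonalizable M

/-- The full subcategory `𝒪(ξ)` of `𝒪`: the modules whose support lies in the set `ξ`. -/
def BlockO (ξ : Set Weight) (M : GMod) : Prop := CatO M ∧ support M ⊆ ξ

/-- The coset `λ + ℤ α`. -/
def rootCoset (lam : Weight) : Set Weight := {μ | ∃ k : ℤ, μ = lam + k • alpha}

theorem self_mem_rootCoset (lam : Weight) : lam ∈ rootCoset lam := ⟨0, by simp⟩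

/-! ### Verma modules and simple highest weight modules -/

/-- The left ideal of `U(𝔤)` generated by `e`, `ē` and all `x - λ(x)` with `x` in the Cartan
subalgebra. -/
def vermaIdeal (lam : Weight) : Submodule U U :=
  Submodule.span U
    ({inc e, inc ebar} ∪ Set.range fun x : cartan => inc x.1 - algebraMap ℂ U (lam x))

/-- The Verma module `Δ(λ) = U(𝔤) ⊗_{U(𝔟)} ℂ_λ`, where `𝔟` is the Borel subalgebra, presented as
the quotient of `U(𝔤)` by the left ideal generated by the annihilator of `ℂ_λ` in `U(𝔟)`. -/
abbrev VermaCarrier (lam : Weight) : Type := U ⧸ vermaIdeal lam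

/-- The largest proper submodule of `Δ(λ)`, as the sum of all proper submodules. -/
def vermaRadical (lam : Weight) : Submodule U (VermaCarrier lam) :=
  sSup {N : Submodule U (VermaCarrier lam) | N ≠ ⊤}

/-- The simple quotient `L(λ)` of the Verma module `Δ(λ)`. -/
def simpleModule (lam : Weight) : GMod where
  carrier := VermaCarrier lam ⧸ vermaRadical lam

/-! ### Extensions -/

/-- `M ⊕ N`. -/
abbrev GMod.prod (M N : GMod) : GMod where
  carrier := M × N

/-- `E` is a subquotient of `X`. -/
def IsSubquotient (E X : GMod) : Prop :=
  ∃ (V : Submodule U X) (g : V →ₗ[U] E), Function.Surjective g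

/-- A condition on `𝔤`-modules (hence a full subcategory) which, together with two objects `S` and
`L`, contains each extension of `L` by `S` that is a subquotient of a sum of two objects. -/
class ExtAdmissible (P : GMod → Prop) : Prop where
  mem : ∀ {S L E M N : GMod} (i : S →ₗ[U] E) (p : E →ₗ[U] L),
    Function.Injective i → Function.Surjective p → Function.Exact i p →
    P S → P L → P M → P N → IsSubquotient E (M.prod N) → P E

/-- A short exact sequence `0 → S → E → L → 0` whose middle term satisfies `P`. -/
structure Extension (P : GMod → Prop) (L S : GMod) where
  /-- The middle term. -/
  E : GMod
  /-- The inclusion. -/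
  i : S →ₗ[U] E
  /-- The projection. -/
  p : E →ₗ[U] L
  inj : Function.Injective i
  surj : Function.Surjective p
  exact : Function.Exact i p
  mem : P E

namespace Extension

variable {P : GMod → Prop} {L S : GMod}

theorem p_i (X : Extension P L S) (s : S) : X.p (X.i s) = 0 := X.exact.apply_apply_eq_zero s

/-- Equivalence of extensions: an isomorphism of the middle terms that is compatible with the
inclusions and the projections. -/
def Equivalent (X Y : Extension P L S) : Prop :=
  ∃ g : X.E ≃ₗ[U] Y.E, (∀ s, g (X.i s) = Y.i s) ∧ ∀ x, Y.p (g x) = X.p x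

instance setoid (P : GMod → Prop) (L S : GMod) : Setoid (Extension P L S) where
  r := Equivalent
  iseqv :=
    { refl := fun X => ⟨LinearEquiv.refl U X.E, fun _ => rfl, fun _ => rfl⟩
      symm := by
        rintro X Y ⟨g, h1, h2⟩
        exact ⟨g.symm, fun s => by rw [← h1, g.symm_apply_apply],
          fun y => by rw [← h2, g.apply_symm_apply]⟩
      trans := by
        rintro X Y Z ⟨g, h1, h2⟩ ⟨g', h1', h2'⟩
        exact ⟨g.trans g', fun s => by simp [h1, h1'], fun x => by simp [h2, h2']⟩ }

/-- The split extension `S ⊕ L`. -/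
def split [ExtAdmissible P] (hL : P L) (hS : P S) : Extension P L S where
  E := S.prod L
  i := LinearMap.inl U S L
  p := LinearMap.snd U S L
  inj := LinearMap.inl_injective
  surj := LinearMap.snd_surjective
  exact := Function.Exact.inl_snd
  mem := ExtAdmissible.mem (LinearMap.inl U S L) (LinearMap.snd U S L) LinearMap.inl_injective
    LinearMap.snd_surjective Function.Exact.inl_snd hS hL hS hL
    ⟨⊤, (⊤ : Submodule U (S.prod L)).subtype, fun x => ⟨⟨x, trivial⟩, rfl⟩⟩

section Baer

variable (X Y : Extension P L S)

/-- The fibre product `X.E ×_L Y.E`. -/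
def baerFib : Submodule U (X.E × Y.E) :=
  LinearMap.ker (X.p ∘ₗ LinearMap.fst U X.E Y.E - Y.p ∘ₗ LinearMap.snd U X.E Y.E)

theorem mem_baerFib (x : X.E × Y.E) : x ∈ baerFib X Y ↔ X.p x.1 = Y.p x.2 := by
  simp [baerFib, sub_eq_zero]

/-- The antidiagonal embedding `s ↦ (i s, - i s)` of `S` in the fibre product. -/
def baerAnti : S →ₗ[U] baerFib X Y :=
  LinearMap.codRestrict _ (LinearMap.prod X.i (-Y.i)) fun s => by
    simp [mem_baerFib, p_i]

/-- The middle term of the Baer sum. -/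
def baerE : GMod where
  carrier := baerFib X Y ⧸ LinearMap.range (baerAnti X Y)

/-- The canonical surjection from the fibre product to the middle term of the Baer sum. -/
def baerMk : baerFib X Y →ₗ[U] baerE X Y := (LinearMap.range (baerAnti X Y)).mkQ

theorem baerMk_surjective : Function.Surjective (baerMk X Y) := Submodule.mkQ_surjective _

theorem baerMk_eq_zero (x : baerFib X Y) :
    baerMk X Y x = 0 ↔ ∃ s, X.i s = x.1.1 ∧ -Y.i s = x.1.2 := by
  refine (Submodule.Quotient.mk_eq_zero _).trans ?_
  simp [LinearMap.mem_range, baerAnti, Subtype.ext_iff, Prod.ext_iff]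

/-- The inclusion of the Baer sum: `s ↦ [(i s, 0)]`. -/
def baerI : S →ₗ[U] baerE X Y :=
  baerMk X Y ∘ₗ LinearMap.codRestrict _ (LinearMap.inl U X.E Y.E ∘ₗ X.i) fun s => by
    simp [mem_baerFib, p_i]

/-- The projection of the Baer sum: `[(x, y)] ↦ p x = p y`. -/
def baerP : baerE X Y →ₗ[U] L :=
  (LinearMap.range (baerAnti X Y)).liftQ
    (X.p ∘ₗ LinearMap.fst U X.E Y.E ∘ₗ (baerFib X Y).subtype) (by
      rintro _ ⟨s, rfl⟩
      simp [baerAnti, p_i])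

theorem baerP_mk (x : baerFib X Y) : baerP X Y (baerMk X Y x) = X.p x.1.1 := rfl

theorem baerI_apply (s : S) :
    baerI X Y s = baerMk X Y ⟨(X.i s, 0), by simp [mem_baerFib, p_i]⟩ := rfl

theorem baerI_injective : Function.Injective (baerI X Y) := by
  rw [injective_iff_map_eq_zero]
  intro s hs
  rw [baerI_apply, baerMk_eq_zero] at hs
  obtain ⟨t, h1, h2⟩ := hs
  have : t = 0 := Y.inj (by simpa using h2)
  subst this
  exact X.inj (by simpa using h1.symm)

theorem baerP_surjective : Function.Surjective (baerP X Y) := by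
  intro l
  obtain ⟨x, rfl⟩ := X.surj l
  obtain ⟨y, hy⟩ := Y.surj (X.p x)
  exact ⟨baerMk X Y ⟨(x, y), by simp [mem_baerFib, hy]⟩, rfl⟩

theorem baer_exact : Function.Exact (baerI X Y) (baerP X Y) := by
  intro q
  constructor
  · intro hq
    obtain ⟨⟨⟨x, y⟩, hxy⟩, rfl⟩ := baerMk_surjective X Y q
    rw [baerP_mk] at hq
    have hxy' := (mem_baerFib X Y _).1 hxy
    obtain ⟨s, rfl⟩ := (X.exact x).1 hq
    obtain ⟨t, rfl⟩ := (Y.exact y).1 (hxy'.symm.trans hq)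
    refine ⟨s + t, ?_⟩
    rw [baerI_apply, ← sub_eq_zero, ← map_sub, baerMk_eq_zero]
    exact ⟨t, by simp, by simp⟩
  · rintro ⟨s, rfl⟩
    rw [baerI_apply, baerP_mk]
    exact X.p_i s

/-- The Baer sum of two extensions. -/
def baer [ExtAdmissible P] (hL : P L) (hS : P S) : Extension P L S where
  E := baerE X Y
  i := baerI X Y
  p := baerP X Y
  inj := baerI_injective X Y
  surj := baerP_surjective X Y
  exact := baer_exact X Y
  mem := ExtAdmissible.mem (baerI X Y) (baerP X Y) (baerI_injective X Y) (baerP_surjective X Y)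
    (baer_exact X Y) hS hL X.mem Y.mem ⟨baerFib X Y, baerMk X Y, baerMk_surjective X Y⟩

end Baer

section Scale

variable (a : ℂ) (X : Extension P L S)

/-- The embedding `s ↦ (i s, - a s)` of `S` in `X.E ⊕ S`. -/
def scaleAnti : S →ₗ[U] X.E × S := LinearMap.prod X.i (-(a • LinearMap.id))

/-- The middle term of the pushout of an extension along the multiplication by `a` on `S`. -/
def scaleE : GMod where
  carrier := (X.E × S) ⧸ LinearMap.range (scaleAnti a X)

/-- The canonical surjection from `X.E ⊕ S` to the pushout. -/
def scaleMk : X.E × S →ₗ[U] scaleE a X := (LinearMap.range (scaleAnti a X)).mkQ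

theorem scaleMk_surjective : Function.Surjective (scaleMk a X) := Submodule.mkQ_surjective _

theorem scaleMk_eq_zero (x : X.E × S) :
    scaleMk a X x = 0 ↔ ∃ s, X.i s = x.1 ∧ -(a • s) = x.2 := by
  refine (Submodule.Quotient.mk_eq_zero _).trans ?_
  simp [LinearMap.mem_range, scaleAnti, Prod.ext_iff]

/-- The inclusion `s ↦ [(0, s)]`. -/
def scaleI : S →ₗ[U] scaleE a X := scaleMk a X ∘ₗ LinearMap.inr U X.E S

/-- The projection `[(x, s)] ↦ p x`. -/
def scaleP : scaleE a X →ₗ[U] L :=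
  (LinearMap.range (scaleAnti a X)).liftQ (X.p ∘ₗ LinearMap.fst U X.E S) (by
    rintro _ ⟨s, rfl⟩
    simp [scaleAnti, p_i])

theorem scaleP_mk (x : X.E × S) : scaleP a X (scaleMk a X x) = X.p x.1 := rfl

theorem scaleI_apply (s : S) : scaleI a X s = scaleMk a X (0, s) := rfl

theorem scaleI_injective : Function.Injective (scaleI a X) := by
  rw [injective_iff_map_eq_zero]
  intro s hs
  rw [scaleI_apply, scaleMk_eq_zero] at hs
  obtain ⟨t, h1, h2⟩ := hs
  have : t = 0 := X.inj (by simpa using h1)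
  subst this
  simpa using h2.symm

theorem scaleP_surjective : Function.Surjective (scaleP a X) := by
  intro l
  obtain ⟨x, rfl⟩ := X.surj l
  exact ⟨scaleMk a X (x, 0), rfl⟩

theorem scale_exact : Function.Exact (scaleI a X) (scaleP a X) := by
  intro q
  constructor
  · intro hq
    obtain ⟨⟨x, s⟩, rfl⟩ := scaleMk_surjective a X q
    rw [scaleP_mk] at hq
    obtain ⟨t, rfl⟩ := (X.exact x).1 hq
    refine ⟨s + a • t, ?_⟩
    rw [scaleI_apply, ← sub_eq_zero, ← map_sub, scaleMk_eq_zero]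
    exact ⟨-t, by simp, by simp⟩
  · rintro ⟨s, rfl⟩
    rw [scaleI_apply, scaleP_mk]
    exact map_zero _

/-- The pushout of an extension along the multiplication by `a` on `S`. -/
def scale [ExtAdmissible P] (hL : P L) (hS : P S) : Extension P L S where
  E := scaleE a X
  i := scaleI a X
  p := scaleP a X
  inj := scaleI_injective a X
  surj := scaleP_surjective a X
  exact := scale_exact a X
  mem := ExtAdmissible.mem (scaleI a X) (scaleP a X) (scaleI_injective a X)
    (scaleP_surjective a X) (scale_exact a X) hS hL X.mem hS
    ⟨⊤, scaleMk a X ∘ₗ (⊤ : Submodule U (X.E.prod S)).subtype, fun q => by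
      obtain ⟨x, rfl⟩ := scaleMk_surjective a X q
      exact ⟨⟨x, trivial⟩, rfl⟩⟩

end Scale

/-- The transport of an extension along isomorphisms of its outer terms. -/
def transport {L' S' : GMod} (l : L ≃ₗ[U] L') (s : S ≃ₗ[U] S') (X : Extension P L S) :
    Extension P L' S' where
  E := X.E
  i := X.i ∘ₗ s.symm.toLinearMap
  p := l.toLinearMap ∘ₗ X.p
  inj := X.inj.comp s.symm.injective
  surj := l.surjective.comp X.surj
  exact := by
    intro x
    simp only [LinearMap.comp_apply, LinearEquiv.coe_coe, map_eq_zero_iff l l.injective]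
    rw [X.exact x]
    constructor
    · rintro ⟨t, rfl⟩
      exact ⟨s t, by simp⟩
    · rintro ⟨t, rfl⟩
      exact ⟨s.symm t, rfl⟩
  mem := X.mem

/-! The cocycles of an extension, used to check that the Baer sum satisfies the axioms of a vector
space. -/

/-- `c` is the cocycle of the extension `X` with respect to some linear section. -/
def HasCocycle (X : Extension P L S) (c : U → L → S) : Prop :=
  ∃ s : L →ₗ[ℂ] X.E, (∀ l, X.p (s l) = l) ∧ ∀ u l, X.i (c u l) = u • s l - s (u • l)

/-- The coboundary of a linear map. -/
def cobound (L S : GMod) : (L →ₗ[ℂ] S) →ₗ[ℂ] (U → L → S) where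
  toFun t u l := u • t l - t (u • l)
  map_add' t t' := by
    funext u l
    simp only [LinearMap.add_apply, Pi.add_apply, smul_add]
    abel
  map_smul' a t := by
    funext u l
    simp only [LinearMap.smul_apply, Pi.smul_apply, RingHom.id_apply, smul_sub, smul_comm u a]

theorem map_smulC {M N : GMod} (g : M →ₗ[U] N) (a : ℂ) (m : M) : g (a • m) = a • g m := by
  rw [← algebraMap_smul U a m, map_smul, algebraMap_smul]

/-- A `U`-linear map as a `ℂ`-linear map. -/
def toC {M N : GMod} (g : M →ₗ[U] N) : M →ₗ[ℂ] N where
  toFun := g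
  map_add' := map_add g
  map_smul' := map_smulC g

theorem exists_cocycle (X : Extension P L S) : ∃ c, X.HasCocycle c := by
  obtain ⟨s, hs⟩ := (toC X.p).exists_rightInverse_of_surjective
    (LinearMap.range_eq_top.2 X.surj)
  have hs' : ∀ l, X.p (s l) = l := fun l => LinearMap.congr_fun hs l
  have : ∀ u l, ∃ t, X.i t = u • s l - s (u • l) := fun u l =>
    (X.exact (u • s l - s (u • l))).1 (by
      rw [map_sub, X.p.map_smul, hs', hs', sub_self])
  choose c hc using this
  exact ⟨c, s, hs', hc⟩

theorem HasCocycle.of_equivalent {X Y : Extension P L S} (hXY : Equivalent X Y) {c : U → L → S}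
    (hc : X.HasCocycle c) : Y.HasCocycle c := by
  obtain ⟨g, h1, h2⟩ := hXY
  obtain ⟨s, hs, hs'⟩ := hc
  refine ⟨toC g.toLinearMap ∘ₗ s, fun l => (h2 _).trans (hs l), fun u l => ?_⟩
  rw [← h1, hs', map_sub, map_smul]
  rfl

theorem HasCocycle.sub_mem {X : Extension P L S} {c c' : U → L → S}
    (hc : X.HasCocycle c) (hc' : X.HasCocycle c') : c - c' ∈ LinearMap.range (cobound L S) := by
  obtain ⟨s, hs, hs'⟩ := hc
  obtain ⟨r, hr, hr'⟩ := hc'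
  have : ∀ l, ∃ t, X.i t = s l - r l := fun l =>
    (X.exact _).1 (by rw [map_sub, hs, hr, sub_self])
  choose t ht using this
  refine ⟨{ toFun := t, map_add' := fun a b => X.inj ?_, map_smul' := fun a b => X.inj ?_ }, ?_⟩
  · rw [map_add, ht, ht, ht, map_add, map_add]
    abel
  · rw [RingHom.id_apply, map_smulC, ht, ht, map_smul, map_smul, smul_sub]
  · funext u l
    refine X.inj ?_
    change X.i (u • t l - t (u • l)) = X.i (c u l - c' u l)
    rw [map_sub, map_sub, map_smul, ht, ht, hs', hr', smul_sub]
    abel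

theorem HasCocycle.add_cobound {X : Extension P L S} {c : U → L → S}
    (hc : X.HasCocycle c) (t : L →ₗ[ℂ] S) : X.HasCocycle (c + cobound L S t) := by
  obtain ⟨s, hs, hs'⟩ := hc
  refine ⟨s + toC X.i ∘ₗ t, fun l => ?_, fun u l => ?_⟩
  · change X.p (s l + X.i (t l)) = l
    rw [map_add, hs, p_i, add_zero]
  · change X.i (c u l + (u • t l - t (u • l))) = u • (s l + X.i (t l)) - (s (u • l) + X.i (t (u • l)))
    rw [map_add, map_sub, map_smul, hs', smul_add]
    abel

theorem equivalent_of_cocycle {X Y : Extension P L S} {c : U → L → S}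
    (hX : X.HasCocycle c) (hY : Y.HasCocycle c) : Equivalent X Y := by
  obtain ⟨s, hs, hs'⟩ := hX
  obtain ⟨r, hr, hr'⟩ := hY
  have : ∀ x, ∃ t, X.i t = x - s (X.p x) := fun x =>
    (X.exact _).1 (by rw [map_sub, hs, sub_self])
  choose t ht using this
  have tadd : ∀ x y, t (x + y) = t x + t y := fun x y => X.inj (by
    rw [map_add, ht, ht, ht, map_add, map_add]; abel)
  have tsmul : ∀ (u : U) x, t (u • x) = u • t x + c u (X.p x) := fun u x => X.inj (by
    rw [map_add, map_smul, ht, ht, hs', map_smul, smul_sub]; abel)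
  let g : X.E →ₗ[U] Y.E :=
    { toFun := fun x => Y.i (t x) + r (X.p x)
      map_add' := fun x y => by
        rw [tadd, map_add, map_add, map_add]; abel
      map_smul' := fun u x => by
        rw [tsmul, map_add, hr', map_smul, X.p.map_smul, RingHom.id_apply, smul_add]; abel }
  have g1 : ∀ a, g (X.i a) = Y.i a := fun a => by
    change Y.i (t (X.i a)) + r (X.p (X.i a)) = Y.i a
    have : t (X.i a) = a := X.inj (by rw [ht, p_i, map_zero, sub_zero])
    rw [this, p_i, map_zero, add_zero]
  have g2 : ∀ x, Y.p (g x) = X.p x := fun x => by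
    change Y.p (Y.i (t x) + r (X.p x)) = X.p x
    rw [map_add, p_i, hr, zero_add]
  have gb : Function.Bijective g := by
    constructor
    · rw [injective_iff_map_eq_zero]
      intro x hx
      have h0 : X.p x = 0 := by rw [← g2, hx, map_zero]
      obtain ⟨a, rfl⟩ := (X.exact x).1 h0
      rw [g1] at hx
      rw [Y.inj (hx.trans (map_zero _).symm), map_zero]
    · intro y
      obtain ⟨x, hx⟩ := X.surj (Y.p y)
      obtain ⟨a, ha⟩ := (Y.exact (y - g x)).1 (by rw [map_sub, g2, hx, sub_self])
      exact ⟨X.i a + x, by rw [map_add, g1, ha]; abel⟩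
  exact ⟨LinearEquiv.ofBijective g gb, g1, g2⟩

theorem hasCocycle_split [ExtAdmissible P] (hL : P L) (hS : P S) :
    (split hL hS).HasCocycle 0 := by
  refine ⟨LinearMap.inr ℂ S L, fun l => rfl, fun u l => ?_⟩
  change ((0 : S), (0 : L)) = u • ((0 : S), l) - ((0 : S), u • l)
  ext <;> simp

theorem HasCocycle.baer [ExtAdmissible P] (hL : P L) (hS : P S) {X Y : Extension P L S}
    {c d : U → L → S} (hX : X.HasCocycle c) (hY : Y.HasCocycle d) :
    (X.baer Y hL hS).HasCocycle (c + d) := by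
  obtain ⟨s, hs, hs'⟩ := hX
  obtain ⟨r, hr, hr'⟩ := hY
  let w : L →ₗ[ℂ] (baerFib X Y : Type) :=
    { toFun := fun l => ⟨(s l, r l), by rw [mem_baerFib, hs, hr]⟩
      map_add' := fun a b => by ext <;> simp
      map_smul' := fun a b => by ext <;> simp }
  have hw : ∀ (a : ℂ) (x : baerFib X Y), baerMk X Y (a • x) = a • baerMk X Y x := fun a x => by
    rw [← algebraMap_smul U a x, map_smul, algebraMap_smul]
  let v : L →ₗ[ℂ] baerE X Y :=
    { toFun := fun l => baerMk X Y (w l)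
      map_add' := fun a b => by rw [map_add, map_add]
      map_smul' := fun a b => by rw [map_smul, hw, RingHom.id_apply] }
  refine ⟨v, fun l => hs l, fun u l => ?_⟩
  change baerMk X Y _ = u • baerMk X Y (w l) - baerMk X Y (w (u • l))
  rw [← map_smul, ← map_sub, ← sub_eq_zero, ← map_sub, baerMk_eq_zero]
  refine ⟨d u l, ?_, ?_⟩
  · change X.i (d u l) = X.i (c u l + d u l) - (u • s l - s (u • l))
    rw [map_add, hs']
    abel
  · change -Y.i (d u l) = 0 - (u • r l - r (u • l))
    rw [hr', zero_sub]

theorem HasCocycle.scale [ExtAdmissible P] (hL : P L) (hS : P S) (a : ℂ) {X : Extension P L S}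
    {c : U → L → S} (hX : X.HasCocycle c) : (X.scale a hL hS).HasCocycle (a • c) := by
  obtain ⟨s, hs, hs'⟩ := hX
  have hw : ∀ (b : ℂ) (x : X.E × S), scaleMk a X (b • x) = b • scaleMk a X x := fun b x => by
    rw [← algebraMap_smul U b x, map_smul, algebraMap_smul]
  let v : L →ₗ[ℂ] scaleE a X :=
    { toFun := fun l => scaleMk a X (s l, 0)
      map_add' := fun b b' => by rw [← map_add]; simp
      map_smul' := fun b b' => by rw [RingHom.id_apply, ← hw]; simp }
  refine ⟨v, fun l => hs l, fun u l => ?_⟩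
  change scaleMk a X (0, a • c u l) = u • scaleMk a X (s l, 0) - scaleMk a X (s (u • l), 0)
  rw [← map_smul, ← map_sub, ← sub_eq_zero, ← map_sub, scaleMk_eq_zero]
  refine ⟨-c u l, ?_, ?_⟩
  · change X.i (-c u l) = 0 - (u • s l - s (u • l))
    rw [map_neg, hs', zero_sub]
  · change -(a • -c u l) = a • c u l - (u • (0 : S) - 0)
    simp

theorem HasCocycle.transport {L' S' : GMod} (l : L ≃ₗ[U] L') (s : S ≃ₗ[U] S')
    {X : Extension P L S} {c : U → L → S} (hX : X.HasCocycle c) :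
    (X.transport l s).HasCocycle fun u a => s (c u (l.symm a)) := by
  obtain ⟨r, hr, hr'⟩ := hX
  refine ⟨r ∘ₗ toC l.symm.toLinearMap, fun a => ?_, fun u a => ?_⟩
  · change l (X.p (r (l.symm a))) = a
    rw [hr, l.apply_symm_apply]
  · change X.i (s.symm (s (c u (l.symm a)))) = u • r (l.symm a) - r (l.symm (u • a))
    rw [s.symm_apply_apply, hr', l.symm.map_smul]

end Extension

/-! ### The first extension space -/

/-- The space `Ext¹(L, S)` in the full subcategory given by `P`: equivalence classes of short exact
sequences `0 → S → E → L → 0` in this subcategory. -/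
def Ext1 (P : GMod → Prop) (L S : {M : GMod // P M}) : Type 1 :=
  Quotient (Extension.setoid P L.1 S.1)

namespace Ext1

open Extension

variable {P : GMod → Prop} {L S : {M : GMod // P M}}

/-- The class of an extension. -/
def mk (X : Extension P L.1 S.1) : Ext1 P L S := Quotient.mk _ X

theorem mk_eq_mk {X Y : Extension P L.1 S.1} :
    (mk X : Ext1 P L S) = mk Y ↔ X.Equivalent Y := Quotient.eq

theorem mk_eq_of_cocycle {X Y : Extension P L.1 S.1} {c : U → L.1 → S.1}
    (hX : X.HasCocycle c) (hY : Y.HasCocycle c) : (mk X : Ext1 P L S) = mk Y :=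
  mk_eq_mk.2 (equivalent_of_cocycle hX hY)

theorem exists_rep (x : Ext1 P L S) :
    ∃ (X : Extension P L.1 S.1) (c : U → L.1 → S.1), x = mk X ∧ X.HasCocycle c := by
  obtain ⟨X, rfl⟩ := Quotient.exists_rep x
  obtain ⟨c, hc⟩ := X.exists_cocycle
  exact ⟨X, c, rfl, hc⟩

variable [ExtAdmissible P]

/-- The zero element is the class of the split extension. -/
instance : Zero (Ext1 P L S) := ⟨mk (split L.2 S.2)⟩

/-- Addition is the Baer sum. -/
instance : Add (Ext1 P L S) :=
  ⟨Quotient.map₂ (fun X Y => X.baer Y L.2 S.2) fun X X' hX Y Y' hY => by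
    obtain ⟨c, hc⟩ := X.exists_cocycle
    obtain ⟨d, hd⟩ := Y.exists_cocycle
    exact equivalent_of_cocycle (hc.baer L.2 S.2 hd)
      ((hc.of_equivalent hX).baer L.2 S.2 (hd.of_equivalent hY))⟩

/-- Multiplication by the scalar `a` is the pushout along the multiplication by `a` on `S`. -/
instance : SMul ℂ (Ext1 P L S) :=
  ⟨fun a => Quotient.map (fun X => X.scale a L.2 S.2) fun X X' hX => by
    obtain ⟨c, hc⟩ := X.exists_cocycle
    exact equivalent_of_cocycle (hc.scale L.2 S.2 a) ((hc.of_equivalent hX).scale L.2 S.2 a)⟩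

instance : Neg (Ext1 P L S) := ⟨fun x => (-1 : ℂ) • x⟩

theorem zero_def : (0 : Ext1 P L S) = mk (split L.2 S.2) := rfl

theorem mk_add (X Y : Extension P L.1 S.1) :
    (mk X + mk Y : Ext1 P L S) = mk (X.baer Y L.2 S.2) := rfl

theorem smul_mk (a : ℂ) (X : Extension P L.1 S.1) :
    (a • mk X : Ext1 P L S) = mk (X.scale a L.2 S.2) := rfl

theorem neg_def (x : Ext1 P L S) : -x = (-1 : ℂ) • x := rfl

instance : AddCommGroup (Ext1 P L S) where
  add_assoc x y z := by
    obtain ⟨X, c, rfl, hc⟩ := exists_rep x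
    obtain ⟨Y, d, rfl, hd⟩ := exists_rep y
    obtain ⟨Z, b, rfl, hb⟩ := exists_rep z
    refine mk_eq_of_cocycle (c := c + d + b) ((hc.baer _ _ hd).baer _ _ hb) ?_
    rw [add_assoc]
    exact hc.baer _ _ (hd.baer _ _ hb)
  zero_add x := by
    obtain ⟨X, c, rfl, hc⟩ := exists_rep x
    refine mk_eq_of_cocycle (c := c) ?_ hc
    have := (hasCocycle_split L.2 S.2).baer L.2 S.2 hc
    rwa [zero_add] at this
  add_zero x := by
    obtain ⟨X, c, rfl, hc⟩ := exists_rep x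
    refine mk_eq_of_cocycle (c := c) ?_ hc
    have := hc.baer L.2 S.2 (hasCocycle_split L.2 S.2)
    rwa [add_zero] at this
  add_comm x y := by
    obtain ⟨X, c, rfl, hc⟩ := exists_rep x
    obtain ⟨Y, d, rfl, hd⟩ := exists_rep y
    refine mk_eq_of_cocycle (c := c + d) (hc.baer _ _ hd) ?_
    rw [add_comm]
    exact hd.baer _ _ hc
  neg_add_cancel x := by
    obtain ⟨X, c, rfl, hc⟩ := exists_rep x
    refine mk_eq_of_cocycle (c := 0) ?_ (hasCocycle_split L.2 S.2)
    have := (hc.scale L.2 S.2 (-1)).baer L.2 S.2 hc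
    rwa [neg_one_smul, neg_add_cancel] at this
  nsmul := nsmulRec
  zsmul := zsmulRec

instance : Module ℂ (Ext1 P L S) where
  one_smul x := by
    obtain ⟨X, c, rfl, hc⟩ := exists_rep x
    refine mk_eq_of_cocycle (c := c) ?_ hc
    have := hc.scale L.2 S.2 1
    rwa [one_smul] at this
  mul_smul a b x := by
    obtain ⟨X, c, rfl, hc⟩ := exists_rep x
    refine mk_eq_of_cocycle (c := (a * b) • c) (hc.scale _ _ _) ?_
    rw [mul_smul]
    exact (hc.scale _ _ _).scale _ _ _
  smul_zero a := by
    refine mk_eq_of_cocycle (c := 0) ?_ (hasCocycle_split L.2 S.2)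
    have := (hasCocycle_split L.2 S.2).scale L.2 S.2 a
    rwa [smul_zero] at this
  smul_add a x y := by
    obtain ⟨X, c, rfl, hc⟩ := exists_rep x
    obtain ⟨Y, d, rfl, hd⟩ := exists_rep y
    refine mk_eq_of_cocycle (c := a • (c + d)) ((hc.baer _ _ hd).scale _ _ _) ?_
    rw [smul_add]
    exact (hc.scale _ _ _).baer _ _ (hd.scale _ _ _)
  add_smul a b x := by
    obtain ⟨X, c, rfl, hc⟩ := exists_rep x
    refine mk_eq_of_cocycle (c := (a + b) • c) (hc.scale _ _ _) ?_
    rw [add_smul]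
    exact (hc.scale _ _ _).baer _ _ (hc.scale _ _ _)
  zero_smul x := by
    obtain ⟨X, c, rfl, hc⟩ := exists_rep x
    refine mk_eq_of_cocycle (c := 0) ?_ (hasCocycle_split L.2 S.2)
    have := hc.scale L.2 S.2 0
    rwa [zero_smul] at this

/-- Isomorphic modules have isomorphic extension spaces. -/
def congr {L' S' : {M : GMod // P M}} (l : L.1 ≃ₗ[U] L'.1) (s : S.1 ≃ₗ[U] S'.1) :
    Ext1 P L S ≃ₗ[ℂ] Ext1 P L' S' where
  toFun := Quotient.map (fun X => X.transport l s) fun X X' hX => by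
    obtain ⟨c, hc⟩ := X.exists_cocycle
    exact equivalent_of_cocycle (hc.transport l s) ((hc.of_equivalent hX).transport l s)
  invFun := Quotient.map (fun X => X.transport l.symm s.symm) fun X X' hX => by
    obtain ⟨c, hc⟩ := X.exists_cocycle
    exact equivalent_of_cocycle (hc.transport l.symm s.symm)
      ((hc.of_equivalent hX).transport l.symm s.symm)
  map_add' x y := by
    obtain ⟨X, c, rfl, hc⟩ := exists_rep x
    obtain ⟨Y, d, rfl, hd⟩ := exists_rep y
    refine mk_eq_of_cocycle ((hc.baer L.2 S.2 hd).transport l s) ?_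
    have := (hc.transport l s).baer L'.2 S'.2 (hd.transport l s)
    convert this using 1
    funext u a
    exact map_add s _ _
  map_smul' a x := by
    obtain ⟨X, c, rfl, hc⟩ := exists_rep x
    refine mk_eq_of_cocycle ((hc.scale L.2 S.2 a).transport l s) ?_
    have := (hc.transport l s).scale L'.2 S'.2 a
    have h2 : (a • fun u b => s (c u (l.symm b)) : U → L'.1 → S'.1) =
        fun u b => s ((a • c) u (l.symm b)) := by
      funext u b
      exact (map_smulC s.toLinearMap _ _).symm
    rw [h2] at this
    exact this
  left_inv x := by
    obtain ⟨X, c, rfl, hc⟩ := exists_rep x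
    refine mk_eq_of_cocycle (c := c) ?_ hc
    have := (hc.transport l s).transport l.symm s.symm
    simpa using this
  right_inv x := by
    obtain ⟨X, c, rfl, hc⟩ := exists_rep x
    refine mk_eq_of_cocycle (c := c) ?_ hc
    have := (hc.transport l.symm s.symm).transport l s
    simpa using this

end Ext1

/-! ### The Gabriel quiver -/

/-- The simple modules in a full subcategory. -/
def SimpleIn (P : GMod → Prop) : Type 1 := {M : {M : GMod // P M} // IsSimpleModule U M.1}

/-- The isomorphism relation on simple modules. -/
instance simpleSetoid (P : GMod → Prop) : Setoid (SimpleIn P) where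
  r M N := Nonempty (M.1.1 ≃ₗ[U] N.1.1)
  iseqv :=
    { refl := fun M => ⟨LinearEquiv.refl U M.1.1⟩
      symm := fun ⟨g⟩ => ⟨g.symm⟩
      trans := fun ⟨g⟩ ⟨g'⟩ => ⟨g.trans g'⟩ }

/-- The vertices of the Gabriel quiver: isomorphism classes of simple modules in the full
subcategory. -/
def Vertex (P : GMod → Prop) : Type 1 := Quotient (simpleSetoid P)

/-- The vertex given by a simple module. -/
def Vertex.mk {P : GMod → Prop} (M : GMod) (hM : P M) (hs : IsSimpleModule U M) : Vertex P :=
  Quotient.mk (simpleSetoid P) ⟨⟨M, hM⟩, hs⟩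

/-- The number of arrows from the class of `L` to the class of `S`: the dimension of
`Ext¹(L, S)`. -/
def numArrows {P : GMod → Prop} [ExtAdmissible P] : Vertex P → Vertex P → Cardinal.{1} :=
  Quotient.lift₂ (fun L S => Module.rank ℂ (Ext1 P L.1 S.1)) fun _ _ _ _ ⟨l⟩ ⟨s⟩ =>
    (Ext1.congr l s).rank_eq

/-- The Gabriel quiver: the arrows from `L` to `S` form a set whose cardinality is the dimension of
`Ext¹(L, S)`. -/
instance gabrielQuiver (P : GMod → Prop) [ExtAdmissible P] : Quiver (Vertex P) where
  Hom v w := (numArrows v w).out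

/-! ### The category `𝒪` and its blocks are admissible -/

theorem aeval_intertwine {M N : GMod} (g : M →ₗ[U] N) (x : G) (q : Polynomial ℂ) (m : M) :
    g (Polynomial.aeval (op M x) q m) = Polynomial.aeval (op N x) q (g m) := by
  induction q using Polynomial.induction_on' generalizing m with
  | add q r hq hr => simp [hq, hr]
  | monomial n a =>
    have : ∀ (n : ℕ) (m : M), g (((op M x) ^ n) m) = ((op N x) ^ n) (g m) := by
      intro n
      induction n with
      | zero => intro m; rfl
      | succ n ih =>
        intro m
        rw [pow_succ, pow_succ, Module.End.mul_apply, Module.End.mul_apply, ih, op_apply, op_apply,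
          g.map_smul]
    rw [Polynomial.aeval_monomial, Polynomial.aeval_monomial, Module.End.mul_apply,
      Module.End.mul_apply, ← this]
    exact Extension.map_smulC g _ _

theorem mem_iSup_eigenspace_iff {V : Type*} [AddCommGroup V] [Module ℂ V] (T : Module.End ℂ V)
    (v : V) : v ∈ ⨆ c : ℂ, T.eigenspace c ↔
      ∃ s : Finset ℂ, Polynomial.aeval T (∏ c ∈ s, (Polynomial.X - Polynomial.C c)) v = 0 := by
  classical
  constructor
  · intro hv
    induction hv using Submodule.iSup_induction' with
    | mem c x hx =>
      refine ⟨{c}, ?_⟩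
      have := Module.End.mem_eigenspace_iff.1 hx
      simp [this]
    | zero => exact ⟨∅, by simp⟩
    | add x y _ _ hx hy =>
      obtain ⟨s, hs⟩ := hx
      obtain ⟨t, ht⟩ := hy
      refine ⟨s ∪ t, ?_⟩
      have key : ∀ (a b : Finset ℂ) (z : V), a ⊆ b →
          Polynomial.aeval T (∏ c ∈ a, (Polynomial.X - Polynomial.C c)) z = 0 →
          Polynomial.aeval T (∏ c ∈ b, (Polynomial.X - Polynomial.C c)) z = 0 := by
        intro a b z hab hz
        rw [← Finset.prod_sdiff hab, map_mul, Module.End.mul_apply, hz, map_zero]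
      rw [map_add, key s _ x Finset.subset_union_left hs, key t _ y Finset.subset_union_right ht,
        add_zero]
  · rintro ⟨s, hs⟩
    induction s using Finset.induction_on generalizing v with
    | empty =>
      have : v = 0 := by simpa using hs
      rw [this]
      exact zero_mem _
    | insert a s ha ih =>
      rw [Finset.prod_insert ha] at hs
      have hco : IsCoprime (Polynomial.X - Polynomial.C a)
          (∏ c ∈ s, (Polynomial.X - Polynomial.C c)) :=
        IsCoprime.prod_right fun c hc => Polynomial.isCoprime_X_sub_C_of_isUnit_sub
          (sub_ne_zero.2 fun hac : a = c => ha (by rwa [hac])).isUnit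
      have hv : v ∈ LinearMap.ker (Polynomial.aeval T
          ((Polynomial.X - Polynomial.C a) * ∏ c ∈ s, (Polynomial.X - Polynomial.C c))) := hs
      rw [← Polynomial.sup_ker_aeval_eq_ker_aeval_mul_of_coprime T hco] at hv
      obtain ⟨x, hx, y, hy, rfl⟩ := Submodule.mem_sup.1 hv
      refine add_mem (Submodule.mem_iSup_of_mem a ?_) (ih y hy)
      rw [Module.End.mem_eigenspace_iff]
      simpa [sub_eq_zero] using hx

theorem hDiagonalizable_of_subquotient {E M N : GMod} (hM : HDiagonalizable M)
    (hN : HDiagonalizable N) (hE : IsSubquotient E (M.prod N)) : HDiagonalizable E := by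
  classical
  obtain ⟨V, g, hg⟩ := hE
  rw [HDiagonalizable, eq_top_iff]
  rintro z -
  obtain ⟨⟨⟨m, n⟩, hv⟩, rfl⟩ := hg z
  obtain ⟨s, hs⟩ := (mem_iSup_eigenspace_iff (op M h) m).1 (by
    rw [HDiagonalizable] at hM; rw [hM]; trivial)
  obtain ⟨t, ht⟩ := (mem_iSup_eigenspace_iff (op N h) n).1 (by
    rw [HDiagonalizable] at hN; rw [hN]; trivial)
  rw [mem_iSup_eigenspace_iff]
  refine ⟨s ∪ t, ?_⟩
  set q : Polynomial ℂ := ∏ c ∈ s ∪ t, (Polynomial.X - Polynomial.C c) with hq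
  have hqm : Polynomial.aeval (op M h) q m = 0 := by
    rw [hq, ← Finset.prod_sdiff Finset.subset_union_left, map_mul, Module.End.mul_apply, hs,
      map_zero]
  have hqn : Polynomial.aeval (op N h) q n = 0 := by
    rw [hq, ← Finset.prod_sdiff Finset.subset_union_right, map_mul, Module.End.mul_apply, ht,
      map_zero]
  let VG : GMod := { carrier := V }
  have h1 := aeval_intertwine (M := VG) (N := E) g h q ⟨(m, n), hv⟩
  have h2 : Polynomial.aeval (op VG h) q (⟨(m, n), hv⟩ : V) = (0 : V) := by
    have h3 := aeval_intertwine (M := VG) (N := M.prod N) V.subtype h q ⟨(m, n), hv⟩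
    have h4 := aeval_intertwine (M := M.prod N) (N := M) (LinearMap.fst U M N) h q (m, n)
    have h5 := aeval_intertwine (M := M.prod N) (N := N) (LinearMap.snd U M N) h q (m, n)
    refine Subtype.ext (h3.trans (Prod.ext ?_ ?_))
    · exact h4.trans hqm
    · exact h5.trans hqn
  rw [← h1]
  exact (congrArg g h2).trans (map_zero g)

theorem borelLocallyFinite_of_subquotient {E M N : GMod} (hM : BorelLocallyFinite M)
    (hN : BorelLocallyFinite N) (hE : IsSubquotient E (M.prod N)) : BorelLocallyFinite E := by
  obtain ⟨V, g, hg⟩ := hE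
  intro z
  obtain ⟨⟨⟨m, n⟩, hv⟩, rfl⟩ := hg z
  obtain ⟨A, hA, hmA, hAst⟩ := hM m
  obtain ⟨B, hB, hnB, hBst⟩ := hN n
  let VG : GMod := { carrier := V }
  let sub : VG →ₗ[ℂ] M × N := Extension.toC (M := VG) (N := M.prod N) V.subtype
  let gC : VG →ₗ[ℂ] E := Extension.toC (M := VG) (N := E) g
  have hfin : FiniteDimensional ℂ ((A.prod B).comap sub) := by
    have hAB : FiniteDimensional ℂ (A.prod B) :=
      Module.Finite.iff_fg.2 ((Module.Finite.iff_fg.1 hA).prod (Module.Finite.iff_fg.1 hB))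
    refine FiniteDimensional.of_injective
      (sub.restrict fun x hx => hx : (A.prod B).comap sub →ₗ[ℂ] A.prod B) ?_
    intro x y hxy
    have hxy' : sub x.1 = sub y.1 := congrArg (fun w : A.prod B => w.1) hxy
    exact Subtype.ext (Subtype.ext hxy')
  refine ⟨((A.prod B).comap sub).map gC, inferInstance, ⟨⟨(m, n), hv⟩, ⟨hmA, hnB⟩, rfl⟩, ?_⟩
  rintro x hx _ ⟨⟨⟨a, b⟩, hab⟩, ⟨ha, hb⟩, rfl⟩
  exact ⟨inc x • (⟨(a, b), hab⟩ : V), ⟨hAst x hx a ha, hBst x hx b hb⟩, g.map_smul _ _⟩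

theorem finite_of_exact {S E L : GMod} (i : S →ₗ[U] E) (p : E →ₗ[U] L)
    (hp : Function.Surjective p) (hip : Function.Exact i p) (hS : Module.Finite U S)
    (hL : Module.Finite U L) : Module.Finite U E :=
  Module.Finite.of_exact hip hp

theorem maxGen_map {M N : GMod} (g : M →ₗ[U] N) (x : G) (c : ℂ) (m : M)
    (hm : m ∈ (op M x).maxGenEigenspace c) : g m ∈ (op N x).maxGenEigenspace c := by
  rw [Module.End.mem_maxGenEigenspace] at hm ⊢
  obtain ⟨k, hk⟩ := hm
  refine ⟨k, ?_⟩
  have := aeval_intertwine g x ((Polynomial.X - Polynomial.C c) ^ k) m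
  simp only [map_pow, map_sub, Polynomial.aeval_X, Polynomial.aeval_C] at this
  have e1 : algebraMap ℂ (Module.End ℂ M) c = c • 1 := Algebra.algebraMap_eq_smul_one c
  have e2 : algebraMap ℂ (Module.End ℂ N) c = c • 1 := Algebra.algebraMap_eq_smul_one c
  rw [e1, e2] at this
  rw [← this, hk, map_zero]

theorem maxGen_of_injective {M N : GMod} (g : M →ₗ[U] N) (hg : Function.Injective g) (x : G)
    (c : ℂ) (m : M) (hm : g m ∈ (op N x).maxGenEigenspace c) :
    m ∈ (op M x).maxGenEigenspace c := by
  rw [Module.End.mem_maxGenEigenspace] at hm ⊢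
  obtain ⟨k, hk⟩ := hm
  refine ⟨k, hg ?_⟩
  have := aeval_intertwine g x ((Polynomial.X - Polynomial.C c) ^ k) m
  simp only [map_pow, map_sub, Polynomial.aeval_X, Polynomial.aeval_C] at this
  have e1 : algebraMap ℂ (Module.End ℂ M) c = c • 1 := Algebra.algebraMap_eq_smul_one c
  have e2 : algebraMap ℂ (Module.End ℂ N) c = c • 1 := Algebra.algebraMap_eq_smul_one c
  rw [e1, e2] at this
  rw [this, hk, map_zero]

theorem support_of_exact {S E L : GMod} (i : S →ₗ[U] E) (p : E →ₗ[U] L)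
    (hi : Function.Injective i) (hip : Function.Exact i p) :
    support E ⊆ support S ∪ support L := by
  intro μ hμ
  obtain ⟨z, ⟨hz1, hz2⟩, hz0⟩ := (Submodule.ne_bot_iff _).1 hμ
  by_cases hpz : p z = 0
  · obtain ⟨s, rfl⟩ := (hip z).1 hpz
    exact Or.inl ((Submodule.ne_bot_iff _).2 ⟨s, ⟨maxGen_of_injective i hi _ _ _ hz1,
      maxGen_of_injective i hi _ _ _ hz2⟩, fun hs => hz0 (by rw [hs, map_zero])⟩)
  · exact Or.inr ((Submodule.ne_bot_iff _).2 ⟨p z, ⟨maxGen_map p _ _ _ hz1,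
      maxGen_map p _ _ _ hz2⟩, hpz⟩)

instance : ExtAdmissible CatO where
  mem i p _ hp hip hS hL hM hN hE :=
    ⟨⟨finite_of_exact i p hp hip hS.1.1 hL.1.1,
      borelLocallyFinite_of_subquotient hM.1.2 hN.1.2 hE⟩,
      hDiagonalizable_of_subquotient hM.2 hN.2 hE⟩

instance (ξ : Set Weight) : ExtAdmissible (BlockO ξ) where
  mem i p hi hp hip hS hL hM hN hE :=
    ⟨ExtAdmissible.mem i p hi hp hip hS.1 hL.1 hM.1 hN.1 hE,
      (support_of_exact i p hi hip).trans (Set.union_subset hS.2 hL.2)⟩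

end Takiff

end

/-!
Since `λ(h̄) = 0` and `λ(h) ∉ ℤ`, the simple module `L(λ + kα)` is the Verma module `sl2Verma c` of
`sl₂` of highest weight `c = λ(h) + 2k`, on which `sl₂ ⊗ x` acts by zero; it is realised on `ℂ[X]`
by differential operators. Indeed this Verma module is simple (`isSimpleModule_sl2Verma`), and a
simple module with a highest weight vector of weight `μ` is `L(μ)`
(`nonempty_equiv_simpleModule`), because every proper submodule of `Δ(μ)` avoids the weight `μ`.
Every simple object of the block has a highest weight vector (`exists_isHighestWeight`); its weight
lies in the support, hence in `λ + ℤα`, so these modules are all the simple objects. They are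
pairwise non-isomorphic because their highest weights differ.

For the extensions of `sl2Verma c` by `sl2Verma d`, the action of `e` on `sl2Verma d` is surjective,
so the highest weight vector of the quotient lifts to one of the same kind, and the extension
splits over `sl₂` (`Extension.exists_normalized`). What remains is the action of `sl₂ ⊗ x`, which is
an `sl₂`-equivariant map `sl₂ ⊗ sl2Verma c → sl2Verma d`. It is determined by the image `y` of
`f ⊗ 1`, a vector of weight `c - 2` that is killed by `e³`
(`Extension.HasCocycle.eq_zero_of_normalized`, `normalized_fbar_one`). As `e` annihilates only the
constants, `y` is a multiple of `X ^ n` with `n ≤ 2` and `d = c - 2 + 2n`, and it vanishes if `d` is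
none of `c - 2`, `c`, `c + 2`. In these three cases an explicit intertwiner (`intertwinerDown`,
`intertwinerLoop`, `intertwinerUp`) gives an extension with `y = X ^ n`. It does not split, because
a coboundary vanishes at `f̄`, which acts by zero on both outer terms. Hence `Ext¹` is then a line,
and it is zero otherwise.
-/

noncomputable section

namespace Takiff

attribute [local instance] LieRing.ofAssociativeRing

/-! ### Generators and relations of `U(𝔤)` -/

theorem sl2_trace (x : Sl2) : x.1 1 1 = -x.1 0 0 := by
  have hx : Matrix.trace x.1 = 0 := x.2
  rw [Matrix.trace_fin_two] at hx
  linear_combination hx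

theorem sl2_eq (x : Sl2) : x = x.1 0 1 • sl2E + x.1 0 0 • sl2H + x.1 1 0 • sl2F := by
  apply Subtype.ext
  ext i j
  fin_cases i <;> fin_cases j <;> simp [sl2E, sl2H, sl2F, sl2_trace]

theorem lie_sl2E_sl2F : ⁅sl2E, sl2F⁆ = sl2H := by
  apply Subtype.ext
  ext i j
  fin_cases i <;> fin_cases j <;> simp [sl2E, sl2H, sl2F, Ring.lie_def]

theorem lie_sl2H_sl2E : ⁅sl2H, sl2E⁆ = (2 : ℂ) • sl2E := by
  apply Subtype.ext
  ext i j
  fin_cases i <;> fin_cases j <;> norm_num [sl2E, sl2H, sl2F, Ring.lie_def]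

theorem lie_sl2H_sl2F : ⁅sl2H, sl2F⁆ = (-2 : ℂ) • sl2F := by
  apply Subtype.ext
  ext i j
  fin_cases i <;> fin_cases j <;> norm_num [sl2E, sl2H, sl2F, Ring.lie_def]

theorem lie_sl2F_sl2E : ⁅sl2F, sl2E⁆ = (-1 : ℂ) • sl2H := by
  rw [← lie_skew, lie_sl2E_sl2F, neg_one_smul]

theorem lie_sl2E_sl2H : ⁅sl2E, sl2H⁆ = (-2 : ℂ) • sl2E := by
  rw [← lie_skew, lie_sl2H_sl2E, neg_smul]

theorem lie_sl2F_sl2H : ⁅sl2F, sl2H⁆ = (2 : ℂ) • sl2F := by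
  rw [← lie_skew, lie_sl2H_sl2F, neg_smul, neg_neg]

/-- Two elements of `𝔤` may be interchanged in a `𝔤`-module at the cost of their bracket. -/
theorem swap_smul {M : Type*} [AddCommGroup M] [Module U M] (x y : G) (m : M) :
    inc x • inc y • m = inc y • inc x • m + inc ⁅x, y⁆ • m := by
  rw [← sub_eq_iff_eq_add']
  simp [inc, LieHom.map_lie, LieRing.of_associative_ring_bracket, sub_smul, mul_smul]

theorem inc_smulC {M : Type*} [AddCommGroup M] [Module ℂ M] [Module U M] [IsScalarTower ℂ U M]
    (a : ℂ) (x : G) (m : M) : inc (a • x) • m = a • inc x • m := by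
  rw [inc, map_smul, smul_assoc]

theorem smulC_comm {M : Type*} [AddCommGroup M] [Module ℂ M] [Module U M] [IsScalarTower ℂ U M]
    (a : ℂ) (u : U) (m : M) : u • a • m = a • u • m := by
  rw [← algebraMap_smul U a m, ← mul_smul, ← Algebra.commutes, mul_smul, algebraMap_smul]

/-! Instance search finds the bracket of `𝔤` as that of a Lie module over itself, so that `simp` does
not apply the general lemmas on Lie rings to it. -/

theorem G_add_lie (x y z : G) : ⁅x + y, z⁆ = ⁅x, z⁆ + ⁅y, z⁆ := add_lie x y z
theorem G_lie_add (x y z : G) : ⁅x, y + z⁆ = ⁅x, y⁆ + ⁅x, z⁆ := lie_add x y z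
theorem G_smul_lie (a : ℂ) (x y : G) : ⁅a • x, y⁆ = a • ⁅x, y⁆ := smul_lie a x y
theorem G_lie_smul (a : ℂ) (x y : G) : ⁅x, a • y⁆ = a • ⁅x, y⁆ := lie_smul a x y
theorem G_zero_lie (x : G) : ⁅(0 : G), x⁆ = 0 := by
  simpa using G_smul_lie 0 0 x
theorem G_lie_zero (x : G) : ⁅x, (0 : G)⁆ = 0 := by
  simpa using G_lie_smul 0 x 0

theorem lie_e_f : ⁅e, f⁆ = h := by simp [e, f, h, lie_sl2E_sl2F, -neg_smul]
theorem lie_h_e : ⁅h, e⁆ = (2 : ℂ) • e := by simp [e, h, lie_sl2H_sl2E, -neg_smul]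
theorem lie_h_f : ⁅h, f⁆ = (-2 : ℂ) • f := by simp [f, h, lie_sl2H_sl2F, -neg_smul]
theorem lie_h_ebar : ⁅h, ebar⁆ = (2 : ℂ) • ebar := by simp [ebar, h, lie_sl2H_sl2E, -neg_smul]
theorem lie_h_hbar : ⁅h, hbar⁆ = 0 := by simp [hbar, h]
theorem lie_hbar_h : ⁅hbar, h⁆ = 0 := by simp [hbar, h]
theorem lie_h_fbar : ⁅h, fbar⁆ = (-2 : ℂ) • fbar := by simp [fbar, h, lie_sl2H_sl2F, -neg_smul]
theorem lie_e_ebar : ⁅e, ebar⁆ = 0 := by simp [e, ebar]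
theorem lie_e_hbar : ⁅e, hbar⁆ = (-2 : ℂ) • ebar := by simp [e, ebar, hbar, lie_sl2E_sl2H, -neg_smul]
theorem lie_e_fbar : ⁅e, fbar⁆ = hbar := by simp [e, fbar, hbar, lie_sl2E_sl2F, -neg_smul]
theorem lie_ebar_f : ⁅ebar, f⁆ = hbar := by simp [f, ebar, hbar, lie_sl2E_sl2F, -neg_smul]
theorem lie_hbar_f : ⁅hbar, f⁆ = (-2 : ℂ) • fbar := by simp [f, fbar, hbar, lie_sl2H_sl2F, -neg_smul]
theorem lie_fbar_f : ⁅fbar, f⁆ = 0 := by simp [f, fbar]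
theorem lie_ebar_fbar : ⁅ebar, fbar⁆ = 0 := by simp [fbar, ebar]
theorem lie_hbar_fbar : ⁅hbar, fbar⁆ = 0 := by simp [fbar, hbar]

/-- An element of `𝔤` is a linear combination of the six standard basis elements. -/
theorem mem_span_basis (x : G) : x ∈ Submodule.span ℂ {e, h, f, ebar, hbar, fbar} := by
  induction x using TensorProduct.induction_on with
  | zero => exact zero_mem _
  | add x y hx hy => exact add_mem hx hy
  | tmul s y =>
    have hs : s = s.fst • (1 : DualNumber ℂ) + s.snd • DualNumber.eps := by
      ext <;> simp
    rw [hs, sl2_eq y]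
    simp only [TensorProduct.add_tmul, TensorProduct.tmul_add,
      TensorProduct.tmul_smul]
    simp only [← TensorProduct.smul_tmul']
    refine add_mem (add_mem ?_ ?_) ?_ <;> refine Submodule.smul_mem _ _ (add_mem ?_ ?_) <;>
      refine Submodule.smul_mem _ _ (Submodule.subset_span ?_) <;>
      simp [e, f, h, ebar, fbar, hbar]

/-- Induction over `U(𝔤)`: a property of its elements that is stable under sums and products and
that holds for scalars and for the elements of `𝔤` holds everywhere. -/
theorem U_induction {p : U → Prop} (hC : ∀ a : ℂ, p (algebraMap ℂ U a)) (hG : ∀ x, p (inc x))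
    (hadd : ∀ u v, p u → p v → p (u + v)) (hmul : ∀ u v, p u → p v → p (u * v)) (u : U) : p u := by
  let A : Subalgebra ℂ U :=
    { carrier := {u | p u}
      mul_mem' := hmul _ _
      add_mem' := hadd _ _
      algebraMap_mem' := hC }
  let g : G →ₗ⁅ℂ⁆ A :=
    { toFun := fun x => ⟨inc x, hG x⟩
      map_add' := fun x y => Subtype.ext (map_add _ x y)
      map_smul' := fun a x => Subtype.ext (map_smul _ a x)
      map_lie' := fun {x y} => Subtype.ext (LieHom.map_lie _ x y) }
  have hg : A.val.comp (UniversalEnvelopingAlgebra.lift ℂ g) = AlgHom.id ℂ U := by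
    apply UniversalEnvelopingAlgebra.hom_ext
    ext x
    change ((UniversalEnvelopingAlgebra.lift ℂ g (inc x) : A) : U) = inc x
    rw [UniversalEnvelopingAlgebra.lift_ι_apply]
    rfl
  have := AlgHom.congr_fun hg u
  rw [← AlgHom.id_apply (R := ℂ) u, ← this]
  exact (UniversalEnvelopingAlgebra.lift ℂ g u).2

/-- A complex subspace of a `𝔤`-module that is stable under the basis of `𝔤` is stable under
`U(𝔤)`. -/
theorem stable_of_basis {M : Type*} [AddCommGroup M] [Module ℂ M] [Module U M]
    [IsScalarTower ℂ U M] (W : Submodule ℂ M)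
    (hW : ∀ x ∈ ({e, h, f, ebar, hbar, fbar} : Set G), ∀ w ∈ W, inc x • w ∈ W) (u : U) :
    ∀ w ∈ W, u • w ∈ W := by
  induction u using U_induction with
  | hC a => intro w hw; rw [algebraMap_smul]; exact W.smul_mem a hw
  | hadd u v hu hv => intro w hw; rw [add_smul]; exact add_mem (hu w hw) (hv w hw)
  | hmul u v hu hv => intro w hw; rw [mul_smul]; exact hu _ (hv w hw)
  | hG x =>
    induction mem_span_basis x using Submodule.span_induction with
    | mem x hx => exact hW x hx
    | zero => intro w _; simp [inc]
    | add x y _ _ hx hy =>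
      intro w hw; rw [inc, map_add, add_smul]; exact add_mem (hx w hw) (hy w hw)
    | smul a x _ hx => intro w hw; rw [inc_smulC]; exact W.smul_mem a (hx w hw)

/-- A complex subspace of a `𝔤`-module that is stable under `h`, `h̄`, `e` and `ē` is stable under
the Borel subalgebra. -/
theorem stable_of_borel_gens {M : Type*} [AddCommGroup M] [Module ℂ M] [Module U M]
    [IsScalarTower ℂ U M] (W : Submodule ℂ M)
    (hW : ∀ x ∈ ({h, hbar, e, ebar} : Set G), ∀ w ∈ W, inc x • w ∈ W) :
    ∀ x ∈ borel, ∀ w ∈ W, inc x • w ∈ W := by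
  let K : LieSubalgebra ℂ G :=
    { carrier := {x | ∀ w ∈ W, inc x • w ∈ W}
      zero_mem' := fun w _ => by simp [inc]
      add_mem' := fun {x y} hx hy w hw => by
        rw [inc, map_add, add_smul]; exact add_mem (hx w hw) (hy w hw)
      smul_mem' := fun a x hx w hw => by rw [inc_smulC]; exact W.smul_mem a (hx w hw)
      lie_mem' := fun {x y} hx hy w hw => by
        have := swap_smul x y w
        rw [← sub_eq_iff_eq_add'] at this
        change inc ⁅x, y⁆ • w ∈ W
        rw [← this]
        exact sub_mem (hx _ (hy w hw)) (hy _ (hx w hw)) }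
  have : borel ≤ K := LieSubalgebra.lieSpan_le.2 hW
  exact fun x hx => this hx

theorem mem_cartan_iff (x : G) : x ∈ cartan ↔ ∃ a b : ℂ, x = a • h + b • hbar := by
  constructor
  · let K : LieSubalgebra ℂ G :=
      { carrier := {x | ∃ a b : ℂ, x = a • h + b • hbar}
        zero_mem' := ⟨0, 0, by simp⟩
        add_mem' := by
          rintro _ _ ⟨a, b, rfl⟩ ⟨a', b', rfl⟩
          exact ⟨a + a', b + b', by module⟩
        smul_mem' := by
          rintro t _ ⟨a, b, rfl⟩
          exact ⟨t * a, t * b, by module⟩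
        lie_mem' := by
          rintro _ _ ⟨a, b, rfl⟩ ⟨a', b', rfl⟩
          refine ⟨0, 0, ?_⟩
          change ⁅(a • h + b • hbar : G), (a' • h + b' • hbar : G)⁆ = _
          have h1 : ⁅h, h⁆ = 0 := lie_self h
          have h2 : ⁅hbar, hbar⁆ = 0 := lie_self hbar
          simp [G_add_lie, G_lie_add, G_smul_lie, G_lie_smul, lie_h_hbar, lie_hbar_h, h1, h2] }
    have : cartan ≤ K := by
      refine LieSubalgebra.lieSpan_le.2 ?_
      rintro x (rfl | rfl)
      · exact ⟨1, 0, by simp⟩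
      · exact ⟨0, 1, by simp⟩
    exact fun hx => this hx
  · rintro ⟨a, b, rfl⟩
    exact add_mem (cartan.smul_mem a cartanH.2) (cartan.smul_mem b cartanHbar.2)

/-- The functional `(s + t x) ⊗ A ↦ t (A₀₀ - A₁₁)` on `𝔤`. -/
def betaFull : G →ₗ[ℂ] ℂ :=
  LinearMap.mul' ℂ ℂ ∘ₗ TensorProduct.map (TrivSqZeroExt.sndHom ℂ ℂ) diagDiff

/-- There is a weight with any prescribed values at `h` and `h̄`. -/
theorem exists_weight (a b : ℂ) : ∃ μ : Weight, μ cartanH = a ∧ μ cartanHbar = b := by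
  let beta : Weight := betaFull ∘ₗ cartan.toSubmodule.subtype
  have h1 : beta cartanH = 0 := by
    change betaFull h = 0
    simp [betaFull, h]
  have h2 : beta cartanHbar = 2 := by
    change betaFull hbar = 2
    simp [betaFull, hbar, diagDiff, sl2H]
    norm_num
  refine ⟨(a / 2) • alpha + (b / 2) • beta, ?_, ?_⟩ <;>
    simp [h1, h2, alpha_h, alpha_hbar]

/-! ### Constructing `𝔤`-modules -/

section Lift

variable {A : Type*} [Ring A] [Algebra ℂ A]

/-- The linear map from `sl₂` with prescribed values on the standard basis. -/
def tripleMap (E H F : A) : Sl2 →ₗ[ℂ] A where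
  toFun x := x.1 0 1 • E + x.1 0 0 • H + x.1 1 0 • F
  map_add' x y := by simp; module
  map_smul' a x := by simp; module

@[simp] theorem tripleMap_E (E H F : A) : tripleMap E H F sl2E = E := by simp [tripleMap, sl2E]
@[simp] theorem tripleMap_H (E H F : A) : tripleMap E H F sl2H = H := by simp [tripleMap, sl2H]
@[simp] theorem tripleMap_F (E H F : A) : tripleMap E H F sl2F = F := by simp [tripleMap, sl2F]

/-- The relations under which the elements `E', H', F'` behave with respect to `E, H, F` as the
standard basis of the adjoint representation of `sl₂`. -/
structure AdjointTriple (E H F E' H' F' : A) : Prop where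
  ee : E * E' = E' * E
  eh : E * H' = H' * E - (2 : ℂ) • E'
  ef : E * F' = F' * E + H'
  he : H * E' = E' * H + (2 : ℂ) • E'
  hh : H * H' = H' * H
  hf : H * F' = F' * H - (2 : ℂ) • F'
  fe : F * E' = E' * F - H'
  fh : F * H' = H' * F + (2 : ℂ) • F'
  ff : F * F' = F' * F

theorem AdjointTriple.lie {E H F E' H' F' : A} (T : AdjointTriple E H F E' H' F') (x y : Sl2) :
    tripleMap E H F x * tripleMap E' H' F' y - tripleMap E' H' F' y * tripleMap E H F x =
      tripleMap E' H' F' ⁅x, y⁆ := by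
  have h1 : ⁅x, y⁆ = (2 * (x.1 0 0 * y.1 0 1 - x.1 0 1 * y.1 0 0)) • sl2E
      + (x.1 0 1 * y.1 1 0 - x.1 1 0 * y.1 0 1) • sl2H
      + (2 * (x.1 1 0 * y.1 0 0 - x.1 0 0 * y.1 1 0)) • sl2F := by
    conv_lhs => rw [sl2_eq x, sl2_eq y]
    simp only [add_lie, lie_add, smul_lie, lie_smul, lie_self, lie_sl2E_sl2F, lie_sl2H_sl2E,
      lie_sl2H_sl2F, lie_sl2F_sl2E, lie_sl2E_sl2H, lie_sl2F_sl2H]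
    module
  rw [h1]
  simp only [map_add, map_smul, tripleMap_E, tripleMap_H, tripleMap_F]
  simp only [tripleMap, LinearMap.coe_mk, AddHom.coe_mk, add_mul, mul_add, smul_mul_assoc,
    mul_smul_comm, T.ee, T.eh, T.ef, T.he, T.hh, T.hf, T.fe, T.fh, T.ff, smul_add, smul_sub]
  module

/-- The algebra homomorphism `U(𝔤) → A` given by a representation `φ` of `sl₂` in `A` and a
`sl₂`-equivariant linear map `ψ : sl₂ → A` with `ψ(sl₂) ψ(sl₂) = 0`, which gives the action of
`sl₂ ⊗ x`. -/
def liftTakiff (φ ψ : Sl2 →ₗ[ℂ] A) (h0 : ∀ x y, φ x * φ y - φ y * φ x = φ ⁅x, y⁆)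
    (h1 : ∀ x y, φ x * ψ y - ψ y * φ x = ψ ⁅x, y⁆) (h2 : ∀ x y, ψ x * ψ y = 0) : U →ₐ[ℂ] A :=
  let g : G →ₗ[ℂ] A := TensorProduct.lift
    ((LinearMap.lsmul ℂ (Sl2 →ₗ[ℂ] A)).flip φ ∘ₗ (TrivSqZeroExt.fstHom ℂ ℂ ℂ).toLinearMap +
      (LinearMap.lsmul ℂ (Sl2 →ₗ[ℂ] A)).flip ψ ∘ₗ TrivSqZeroExt.sndHom ℂ ℂ)
  have hg : ∀ s x, g (s ⊗ₜ x) = s.fst • φ x + s.snd • ψ x := fun s x => rfl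
  UniversalEnvelopingAlgebra.lift ℂ
    { g with
      map_lie' := fun {x y} => by
        change g ⁅x, y⁆ = g x * g y - g y * g x
        induction x using TensorProduct.induction_on with
        | zero => simp [G_zero_lie]
        | add x x' hx hx' => simp only [G_add_lie, map_add, hx, hx', add_mul, mul_add]; abel
        | tmul s x =>
          induction y using TensorProduct.induction_on with
          | zero => simp [G_lie_zero]
          | add y y' hy hy' => simp only [G_lie_add, map_add, hy, hy', add_mul, mul_add]; abel
          | tmul t y =>
            have h3 : ψ x * φ y = φ y * ψ x + ψ ⁅x, y⁆ := by
              rw [← lie_skew, map_neg, ← h1 y x]; abel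
            rw [LieAlgebra.ExtendScalars.bracket_tmul, hg, hg, hg, ← h0]
            simp only [add_mul, mul_add, smul_mul_assoc, mul_smul_comm, h2, h3, ← h1]
            simp only [TrivSqZeroExt.fst_mul, TrivSqZeroExt.snd_mul, smul_eq_mul,
              MulOpposite.smul_eq_mul_unop, MulOpposite.unop_op]
            module }

variable (φ ψ : Sl2 →ₗ[ℂ] A) (h0 : ∀ x y, φ x * φ y - φ y * φ x = φ ⁅x, y⁆)
    (h1 : ∀ x y, φ x * ψ y - ψ y * φ x = ψ ⁅x, y⁆) (h2 : ∀ x y, ψ x * ψ y = 0)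

theorem liftTakiff_one (x : Sl2) :
    liftTakiff φ ψ h0 h1 h2 (inc ((1 : DualNumber ℂ) ⊗ₜ x)) = φ x := by
  rw [liftTakiff, inc, UniversalEnvelopingAlgebra.lift_ι_apply]
  change (1 : DualNumber ℂ).fst • φ x + (1 : DualNumber ℂ).snd • ψ x = φ x
  simp

theorem liftTakiff_eps (x : Sl2) :
    liftTakiff φ ψ h0 h1 h2 (inc ((DualNumber.eps : DualNumber ℂ) ⊗ₜ x)) = ψ x := by
  rw [liftTakiff, inc, UniversalEnvelopingAlgebra.lift_ι_apply]
  change (DualNumber.eps : DualNumber ℂ).fst • φ x + (DualNumber.eps : DualNumber ℂ).snd • ψ x = _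
  simp

end Lift

/-- The `𝔤`-module given by a representation of `U(𝔤)` on a complex vector space. -/
def GMod.ofRep (V : Type) [AddCommGroup V] [Module ℂ V] (ρ : U →ₐ[ℂ] Module.End ℂ V) : GMod :=
  letI : Module U V := Module.compHom V ρ.toRingHom
  { carrier := V
    tower := ⟨fun a u v => by
      change ρ (a • u) v = a • ρ u v
      rw [map_smul, LinearMap.smul_apply]⟩ }

open Polynomial

/-! ### The Verma modules of `sl₂` as modules over the Takiff algebra -/

theorem C_two : (C 2 : ℂ[X]) = 2 := map_ofNat C 2

/-- The operator `e` on the Verma module of `sl₂` of highest weight `c`, realised on `ℂ[X]`. -/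
def opE (c : ℂ) : Module.End ℂ ℂ[X] :=
  c • derivative - LinearMap.mulLeft ℂ X ∘ₗ derivative ∘ₗ derivative

/-- The operator `h` on the Verma module of `sl₂` of highest weight `c`, realised on `ℂ[X]`. -/
def opH (c : ℂ) : Module.End ℂ ℂ[X] :=
  c • LinearMap.id - (2 : ℂ) • LinearMap.mulLeft ℂ X ∘ₗ derivative

/-- The operator `f` on the Verma module of `sl₂`, realised on `ℂ[X]`. -/
def opF : Module.End ℂ ℂ[X] := LinearMap.mulLeft ℂ X

theorem opE_apply (c : ℂ) (p : ℂ[X]) :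
    opE c p = C c * derivative p - X * derivative (derivative p) := by
  simp [opE, smul_eq_C_mul]

theorem opH_apply (c : ℂ) (p : ℂ[X]) : opH c p = C c * p - 2 * X * derivative p := by
  simp [opH, smul_eq_C_mul, mul_assoc, C_two]

theorem opF_apply (p : ℂ[X]) : opF p = X * p := rfl

theorem opE_X_pow_succ (c : ℂ) (n : ℕ) :
    opE c (X ^ (n + 1)) = C ((n + 1) * (c - n)) * X ^ n := by
  rw [opE_apply]
  cases n with
  | zero => simp
  | succ n =>
    simp
    ring

theorem opH_X_pow (c : ℂ) (n : ℕ) : opH c (X ^ n) = C (c - 2 * n) * X ^ n := by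
  rw [opH_apply]
  cases n with
  | zero => simp
  | succ n =>
    simp [C_two]
    ring

theorem adjointTriple_self (c : ℂ) :
    AdjointTriple (opE c) (opH c) opF (opE c) (opH c) opF := by
  constructor <;> apply LinearMap.ext <;> intro p <;>
    simp only [Module.End.mul_apply, LinearMap.add_apply, LinearMap.sub_apply,
      LinearMap.smul_apply, opE_apply, opH_apply, opF_apply, smul_eq_C_mul] <;>
    simp [C_two] <;> ring

/-- The action of `U(𝔤)` on the Verma module of `sl₂`, through `𝔤 → sl₂`. -/
def vermaRep (c : ℂ) : U →ₐ[ℂ] Module.End ℂ ℂ[X] :=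
  liftTakiff (tripleMap (opE c) (opH c) opF) 0 (adjointTriple_self c).lie (by simp) (by simp)

/-- The Verma module of `sl₂` of highest weight `c`, as a `𝔤`-module on which `sl₂ ⊗ x` acts by
zero. It is realised on `ℂ[X]`, with `f` acting as multiplication by `X`. -/
def sl2Verma (c : ℂ) : GMod := GMod.ofRep ℂ[X] (vermaRep c)

/-- The vector of `sl2Verma c` given by a polynomial. -/
def vec (c : ℂ) : ℂ[X] ≃ₗ[ℂ] sl2Verma c := LinearEquiv.refl ℂ ℂ[X]

variable (c : ℂ) (p : ℂ[X])

theorem e_vec : inc e • vec c p = vec c (opE c p) := by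
  change vermaRep c (inc e) p = _
  rw [vermaRep, e, liftTakiff_one, tripleMap_E]; rfl

theorem h_vec : inc h • vec c p = vec c (opH c p) := by
  change vermaRep c (inc h) p = _
  rw [vermaRep, h, liftTakiff_one, tripleMap_H]; rfl

theorem f_vec : inc f • vec c p = vec c (X * p) := by
  change vermaRep c (inc f) p = _
  rw [vermaRep, f, liftTakiff_one, tripleMap_F]; rfl

theorem eps_vec (x : Sl2) (m : sl2Verma c) :
    inc ((DualNumber.eps : DualNumber ℂ) ⊗ₜ x) • m = 0 := by
  change vermaRep c (inc _) (show ℂ[X] from m) = _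
  rw [vermaRep, liftTakiff_eps]; rfl

theorem ebar_sl2Verma (m : sl2Verma c) : inc ebar • m = 0 := eps_vec c _ m
theorem hbar_sl2Verma (m : sl2Verma c) : inc hbar • m = 0 := eps_vec c _ m
theorem fbar_sl2Verma (m : sl2Verma c) : inc fbar • m = 0 := eps_vec c _ m

theorem vec_surj (m : sl2Verma c) : ∃ p, vec c p = m := (vec c).surjective m

theorem vec_C_mul (a : ℂ) : vec c (C a * p) = a • vec c p := by
  rw [← map_smul, smul_eq_C_mul]

theorem h_vec_X_pow (n : ℕ) : inc h • vec c (X ^ n) = (c - 2 * n) • vec c (X ^ n) := by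
  rw [h_vec, opH_X_pow, vec_C_mul]

theorem e_vec_X_pow_succ (n : ℕ) :
    inc e • vec c (X ^ (n + 1)) = ((n + 1) * (c - n)) • vec c (X ^ n) := by
  rw [e_vec, opE_X_pow_succ, vec_C_mul]

theorem e_vec_one : inc e • vec c 1 = 0 := by
  rw [e_vec, opE_apply]
  simp

theorem h_vec_one : inc h • vec c 1 = c • vec c 1 := by
  simpa using h_vec_X_pow c 0

theorem f_pow_vec_one (n : ℕ) : inc f ^ n • vec c 1 = vec c (X ^ n) := by
  induction n with
  | zero => simp
  | succ n ih => rw [pow_succ', mul_smul, ih, f_vec, pow_succ']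

/-- The vectors `X ^ n` span. -/
theorem vec_mem {W : Submodule ℂ (sl2Verma c)} (hW : ∀ n, vec c (X ^ n) ∈ W)
    (m : sl2Verma c) : m ∈ W := by
  obtain ⟨p, rfl⟩ := vec_surj c m
  induction p using Polynomial.induction_on' with
  | add p q hp hq => rw [map_add]; exact add_mem hp hq
  | monomial n a => rw [← C_mul_X_pow_eq_monomial, vec_C_mul]; exact W.smul_mem a (hW n)

theorem opE_coeff (n : ℕ) : (opE c p).coeff n = (n + 1) * (c - n) * p.coeff (n + 1) := by
  rw [opE_apply]
  cases n with
  | zero => simp [coeff_derivative]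
  | succ n =>
    simp [coeff_derivative]
    ring

theorem opH_coeff (n : ℕ) : (opH c p).coeff n = (c - 2 * n) * p.coeff n := by
  rw [opH_apply, mul_assoc]
  cases n with
  | zero => simp [coeff_derivative, coeff_ofNat_mul]
  | succ n =>
    simp [coeff_derivative, coeff_ofNat_mul]
    ring

variable {c p}

/-- The scalar by which `e` lowers the degree does not vanish. -/
theorem lowering_ne_zero (hc : ∀ n : ℤ, c ≠ n) (n : ℕ) : ((n : ℂ) + 1) * (c - n) ≠ 0 :=
  mul_ne_zero (by exact_mod_cast n.succ_ne_zero) (sub_ne_zero.2 (by simpa using hc n))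

/-- The highest weight vectors are the constants. -/
theorem eq_C_of_opE_eq_zero (hc : ∀ n : ℤ, c ≠ n) (hp : opE c p = 0) : p = C (p.coeff 0) := by
  ext n
  cases n with
  | zero => simp
  | succ n =>
    have := opE_coeff c p n
    rw [hp, coeff_zero, eq_comm, mul_eq_zero] at this
    simpa using this.resolve_left (lowering_ne_zero hc n)

theorem natDegree_opE_lt (hp : p.natDegree ≠ 0) : (opE c p).natDegree < p.natDegree := by
  rw [Nat.lt_iff_le_pred (Nat.pos_of_ne_zero hp), natDegree_le_iff_coeff_eq_zero]
  intro n hn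
  rw [opE_coeff, coeff_eq_zero_of_natDegree_lt (by omega), mul_zero]

theorem exists_smul_eq_one (hc : ∀ n : ℤ, c ≠ n) (hp : p ≠ 0) :
    ∃ u : U, u • vec c p = vec c 1 := by
  induction hn : p.natDegree using Nat.strong_induction_on generalizing p with
  | _ n ih =>
    by_cases h0 : opE c p = 0
    · have h1 := eq_C_of_opE_eq_zero hc h0
      have h2 : p.coeff 0 ≠ 0 := fun h2 => hp (by rw [h1, h2, C_0])
      refine ⟨algebraMap ℂ U (p.coeff 0)⁻¹, ?_⟩
      rw [algebraMap_smul, ← vec_C_mul]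
      congr 1
      conv_lhs => rw [h1]
      simp [← C_mul, h2]
    · have h1 : p.natDegree ≠ 0 := fun h1 => h0 (by
        rw [eq_C_of_natDegree_eq_zero h1, opE_apply]; simp)
      obtain ⟨u, hu⟩ := ih _ (hn ▸ natDegree_opE_lt h1) h0 rfl
      exact ⟨u * inc e, by rw [mul_smul, e_vec, hu]⟩

theorem span_vec_one (c : ℂ) : Submodule.span U {vec c 1} = ⊤ := by
  rw [eq_top_iff]
  rintro m -
  refine vec_mem c (W := (Submodule.span U {vec c 1}).restrictScalars ℂ) (fun n => ?_) m
  rw [← f_pow_vec_one]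
  exact Submodule.smul_mem _ _ (Submodule.mem_span_singleton_self _)

instance (c : ℂ) : Nontrivial (sl2Verma c) := inferInstanceAs (Nontrivial ℂ[X])

theorem isSimpleModule_sl2Verma (hc : ∀ n : ℤ, c ≠ n) : IsSimpleModule U (sl2Verma c) := by
  refine { eq_bot_or_eq_top := fun N => ?_ }
  refine or_iff_not_imp_left.2 fun hN => ?_
  obtain ⟨m, hm, hm0⟩ := (Submodule.ne_bot_iff _).1 hN
  obtain ⟨p, rfl⟩ := vec_surj c m
  obtain ⟨u, hu⟩ := exists_smul_eq_one hc (p := p) (fun h0 => hm0 (by rw [h0, map_zero]))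
  rw [eq_top_iff, ← span_vec_one, Submodule.span_singleton_le_iff_mem, ← hu]
  exact N.smul_mem u hm

/-- Modules of different highest weight are not isomorphic. -/
theorem eq_of_sl2Verma_equiv {c d : ℂ} (hd : ∀ n : ℤ, d ≠ n)
    (g : sl2Verma c ≃ₗ[U] sl2Verma d) : c = d := by
  obtain ⟨p, hp⟩ := vec_surj d (g (vec c 1))
  have he : opE d p = 0 := (vec d).injective (by
    rw [← e_vec, hp, ← map_smul, e_vec_one, map_zero, map_zero])
  have hpC := eq_C_of_opE_eq_zero hd he
  have hp0 : vec d p ≠ 0 := by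
    rw [hp]
    exact (map_ne_zero_iff g g.injective).2 ((map_ne_zero_iff _ (vec c).injective).2 one_ne_zero)
  have h1 : inc h • vec d p = c • vec d p := by
    rw [hp, ← map_smul, h_vec_one]
    exact Extension.map_smulC (M := sl2Verma c) (N := sl2Verma d) g.toLinearMap c _
  have h2 : inc h • vec d p = d • vec d p := by
    rw [hpC, ← mul_one (C _), vec_C_mul, smulC_comm, h_vec_one, smul_comm]
  exact smul_left_injective ℂ hp0 (h1.symm.trans h2)

/-! ### Highest weight vectors -/

/-- `v` is a highest weight vector: it is killed by `e` and `ē`, and it is an eigenvector of `h`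
and `h̄` with eigenvalues `a` and `b`. -/
structure IsHighestWeight {M : Type*} [AddCommGroup M] [Module ℂ M] [Module U M] (v : M)
    (a b : ℂ) : Prop where
  e : inc e • v = 0
  ebar : inc ebar • v = 0
  h : inc h • v = a • v
  hbar : inc hbar • v = b • v

theorem isHighestWeight_vec_one (c : ℂ) : IsHighestWeight (vec c 1) c 0 :=
  ⟨e_vec_one c, ebar_sl2Verma c _, h_vec_one c, by rw [hbar_sl2Verma, zero_smul]⟩

section HighestWeight

variable {M : Type*} [AddCommGroup M] [Module U M] {v : M} {a b : ℂ}

/-- The vector `f ^ i f̄ ^ j v`. -/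
def lowered (v : M) (ij : ℕ × ℕ) : M := inc f ^ ij.1 • inc fbar ^ ij.2 • v

theorem f_lowered (i j : ℕ) : inc f • lowered v (i, j) = lowered v (i + 1, j) := by
  rw [lowered, ← mul_smul, ← pow_succ']; rfl

theorem fbar_lowered (i j : ℕ) : inc fbar • lowered v (i, j) = lowered v (i, j + 1) := by
  induction i with
  | zero => simp only [lowered, pow_zero, one_smul]; rw [← mul_smul, ← pow_succ']
  | succ i ih =>
    rw [← f_lowered, swap_smul, lie_fbar_f, ih, f_lowered]
    simp [inc]

variable [Module ℂ M] [IsScalarTower ℂ U M]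

theorem h_lowered (hv : inc h • v = a • v) (i j : ℕ) :
    inc h • lowered v (i, j) = (a - 2 * (i + j)) • lowered v (i, j) := by
  induction i with
  | succ i ih =>
    rw [← f_lowered, swap_smul, lie_h_f, ih, inc_smulC, smulC_comm, f_lowered]
    push_cast
    module
  | zero =>
    induction j with
    | zero => simpa [lowered] using hv
    | succ j ih =>
      rw [← fbar_lowered, swap_smul, lie_h_fbar, ih, inc_smulC, smulC_comm, fbar_lowered]
      push_cast
      module

/-- A highest weight vector generates the linear span of the vectors `f ^ i f̄ ^ j v`. -/
theorem smul_mem_span_lowered (hv : IsHighestWeight v a b) (u : U) :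
    u • v ∈ Submodule.span ℂ (Set.range (lowered v)) := by
  set W := Submodule.span ℂ (Set.range (lowered v)) with hW
  have hmem : ∀ ij, lowered v ij ∈ W := fun ij => Submodule.subset_span ⟨ij, rfl⟩
  -- It suffices to check stability on the spanning vectors.
  have hred : ∀ x : G, (∀ i j, inc x • lowered v (i, j) ∈ W) → ∀ w ∈ W, inc x • w ∈ W := by
    intro x hx w hw
    induction hw using Submodule.span_induction with
    | mem w hw => obtain ⟨⟨i, j⟩, rfl⟩ := hw; exact hx i j
    | zero => rw [smul_zero]; exact zero_mem _
    | add w w' _ _ hw hw' => rw [smul_add]; exact add_mem hw hw'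
    | smul t w _ hw => rw [smulC_comm]; exact W.smul_mem t hw
  have hf := hred f fun i j => by rw [f_lowered]; exact hmem _
  have hfbar := hred fbar fun i j => by rw [fbar_lowered]; exact hmem _
  have hh := hred h fun i j => by rw [h_lowered hv.h]; exact W.smul_mem _ (hmem _)
  have hhbar := hred hbar fun i j => by
    induction i with
    | succ i ih =>
      rw [← f_lowered, swap_smul, lie_hbar_f, inc_smulC]
      exact add_mem (hf _ ih) (W.smul_mem _ (hfbar _ (hmem _)))
    | zero =>
      induction j with
      | zero => simpa [lowered, hv.hbar, -UniversalEnvelopingAlgebra.ι_apply] using W.smul_mem b (hmem (0, 0))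
      | succ j ih =>
        rw [← fbar_lowered, swap_smul, lie_hbar_fbar]
        exact add_mem (hfbar _ ih) (by simp [inc])
  have hebar := hred ebar fun i j => by
    induction i with
    | succ i ih =>
      rw [← f_lowered, swap_smul, lie_ebar_f]
      exact add_mem (hf _ ih) (hhbar _ (hmem _))
    | zero =>
      induction j with
      | zero => simp only [lowered, pow_zero, one_smul, hv.ebar]; exact zero_mem _
      | succ j ih =>
        rw [← fbar_lowered, swap_smul, lie_ebar_fbar]
        exact add_mem (hfbar _ ih) (by simp [inc])
  have he := hred e fun i j => by
    induction i with
    | succ i ih =>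
      rw [← f_lowered, swap_smul, lie_e_f]
      exact add_mem (hf _ ih) (hh _ (hmem _))
    | zero =>
      induction j with
      | zero => simp only [lowered, pow_zero, one_smul, hv.e]; exact zero_mem _
      | succ j ih =>
        rw [← fbar_lowered, swap_smul, lie_e_fbar]
        exact add_mem (hfbar _ ih) (hhbar _ (hmem _))
  refine stable_of_basis W ?_ u v (by simpa [lowered] using hmem (0, 0))
  rintro x (rfl | rfl | rfl | rfl | rfl | rfl) <;> assumption

theorem aeval_smul_of_eigen {m : M} {s : ℂ} (hm : inc h • m = s • m) (q : ℂ[X]) :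
    aeval (inc h) q • m = q.eval s • m := by
  induction q using Polynomial.induction_on' with
  | add p q hp hq => rw [map_add, add_smul, hp, hq, eval_add, add_smul]
  | monomial n t =>
    have : ∀ n : ℕ, inc h ^ n • m = s ^ n • m := by
      intro n
      induction n with
      | zero => simp
      | succ n ih => rw [pow_succ, mul_smul, hm, smulC_comm, ih, smul_smul, pow_succ']
    rw [aeval_monomial, mul_smul, this, algebraMap_smul, eval_monomial, mul_smul]

/-- A highest weight vector can be separated from the weight spaces below it: each element of the
module generated by `v` is of the form `t v + w`, where `w` is killed by some polynomial in `h`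
that does not vanish at the weight of `v`. -/
theorem exists_decomp (hv : IsHighestWeight v a b) (u : U) :
    ∃ (t : ℂ) (w : M) (q : ℂ[X]), u • v = t • v + w ∧ q.eval a ≠ 0 ∧
      aeval (inc h) q • w = 0 := by
  have hu := smul_mem_span_lowered hv u
  generalize u • v = m at hu ⊢
  induction hu using Submodule.span_induction with
  | zero => exact ⟨0, 0, 1, by simp⟩
  | smul s m _ hm =>
    obtain ⟨t, w, q, rfl, h1, h2⟩ := hm
    exact ⟨s * t, s • w, q, by module, h1, by rw [smulC_comm, h2, smul_zero]⟩
  | add m m' _ _ hm hm' =>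
    obtain ⟨t, w, q, rfl, h1, h2⟩ := hm
    obtain ⟨t', w', q', rfl, h1', h2'⟩ := hm'
    refine ⟨t + t', w + w', q * q', by module, by simp [h1, h1'], ?_⟩
    rw [smul_add, mul_comm q q', map_mul, mul_smul, h2, smul_zero, zero_add, ← map_mul,
      mul_comm q' q, map_mul, mul_smul, h2', smul_zero]
  | mem m hm =>
    obtain ⟨⟨i, j⟩, rfl⟩ := hm
    by_cases hij : i + j = 0
    · obtain ⟨rfl, rfl⟩ : i = 0 ∧ j = 0 := by omega
      exact ⟨1, 0, 1, by simp [lowered]⟩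
    · refine ⟨0, lowered v (i, j), X - C (a - 2 * (i + j)), by simp, ?_, ?_⟩
      · have : (i : ℂ) + j ≠ 0 := by exact_mod_cast hij
        simpa using this
      · rw [aeval_smul_of_eigen (h_lowered hv.h i j)]
        simp

end HighestWeight

/-! ### Simple quotients of Verma modules -/

section Verma

variable {M : Type*} [AddCommGroup M] [Module ℂ M] [Module U M] [IsScalarTower ℂ U M]
  {v : M} {μ : Weight}

/-- The highest weight vector of the Verma module. -/
def vermaVec (μ : Weight) : VermaCarrier μ := (vermaIdeal μ).mkQ 1

theorem exists_smul_vermaVec (μ : Weight) (m : VermaCarrier μ) : ∃ u : U, u • vermaVec μ = m := by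
  obtain ⟨u, rfl⟩ := (vermaIdeal μ).mkQ_surjective m
  exact ⟨u, by rw [vermaVec, ← map_smul, smul_eq_mul, mul_one]⟩

theorem isHighestWeight_vermaVec (μ : Weight) :
    IsHighestWeight (vermaVec μ) (μ cartanH) (μ cartanHbar) := by
  have key : ∀ u ∈ vermaIdeal μ, u • vermaVec μ = 0 := fun u hu => by
    rw [vermaVec, ← map_smul, smul_eq_mul, mul_one]
    exact (Submodule.Quotient.mk_eq_zero _).2 hu
  have key' : ∀ x : cartan, inc x.1 • vermaVec μ = μ x • vermaVec μ := fun x => by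
    rw [← sub_eq_zero, ← algebraMap_smul U (μ x), ← sub_smul]
    exact key _ (Submodule.subset_span (Or.inr ⟨x, rfl⟩))
  exact ⟨key _ (Submodule.subset_span (Or.inl (Or.inl rfl))),
    key _ (Submodule.subset_span (Or.inl (Or.inr rfl))), key' cartanH, key' cartanHbar⟩

/-- The universal property of the Verma module. -/
def vermaLift (hv : IsHighestWeight v (μ cartanH) (μ cartanHbar)) : VermaCarrier μ →ₗ[U] M :=
  (vermaIdeal μ).liftQ (LinearMap.toSpanSingleton U M v) (by
    refine Submodule.span_le.2 ?_
    rintro _ ((rfl | rfl) | ⟨⟨x, hx⟩, rfl⟩)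
    · exact hv.e
    · exact hv.ebar
    · have hx' := hx
      rw [mem_cartan_iff] at hx'
      obtain ⟨s, t, rfl⟩ := hx'
      have h1 : (⟨s • h + t • hbar, hx⟩ : cartan) = s • cartanH + t • cartanHbar := rfl
      change (inc (s • h + t • hbar) - algebraMap ℂ U (μ _)) • v = 0
      rw [h1, sub_smul, algebraMap_smul, inc, map_add, add_smul, inc_smulC, inc_smulC, hv.h,
        hv.hbar, map_add, map_smul, map_smul, smul_eq_mul, smul_eq_mul]
      module)

theorem vermaLift_vermaVec (hv : IsHighestWeight v (μ cartanH) (μ cartanHbar)) :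
    vermaLift hv (vermaVec μ) = v := one_smul U v

/-- Every proper submodule of a Verma module is contained in the kernel of each map to a simple
module that does not kill the highest weight vector. -/
theorem le_ker_vermaLift [IsSimpleModule U M]
    (hv : IsHighestWeight v (μ cartanH) (μ cartanHbar)) (hv0 : v ≠ 0)
    {N : Submodule U (VermaCarrier μ)} (hN : N ≠ ⊤) : N ≤ LinearMap.ker (vermaLift hv) := by
  by_contra hle
  have hmap : N.map (vermaLift hv) = ⊤ :=
    (eq_bot_or_eq_top _).resolve_left fun hbot => hle <| LinearMap.le_ker_iff_map.2 hbot
  obtain ⟨n, hn, hnv⟩ : v ∈ N.map (vermaLift hv) := by rw [hmap]; trivial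
  obtain ⟨u, rfl⟩ := exists_smul_vermaVec μ n
  obtain ⟨t, w, q, hu, hq, hqw⟩ := exists_decomp (isHighestWeight_vermaVec μ) u
  have hqn : aeval (inc h) q • u • vermaVec μ = (t * q.eval (μ cartanH)) • vermaVec μ := by
    rw [hu, smul_add, hqw, add_zero, smulC_comm,
      aeval_smul_of_eigen (isHighestWeight_vermaVec μ).h, smul_smul]
  have ht : t ≠ 0 := by
    rintro rfl
    have h1 := congrArg (vermaLift hv) hqn
    rw [map_smul, hnv, aeval_smul_of_eigen hv.h, zero_mul, zero_smul, map_zero] at h1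
    exact smul_ne_zero hq hv0 h1
  have hmem : vermaVec μ ∈ N := by
    have h1 := N.smul_mem (algebraMap ℂ U (t * q.eval (μ cartanH))⁻¹)
      (N.smul_mem (aeval (inc h) q) hn)
    rwa [hqn, algebraMap_smul, smul_smul, inv_mul_cancel₀ (mul_ne_zero ht hq), one_smul] at h1
  refine hN (eq_top_iff.2 fun m _ => ?_)
  obtain ⟨u', rfl⟩ := exists_smul_vermaVec μ m
  exact N.smul_mem u' hmem

/-- A simple module with a highest weight vector of weight `μ` is isomorphic to `L(μ)`. -/
theorem nonempty_equiv_simpleModule [IsSimpleModule U M]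
    (hv : IsHighestWeight v (μ cartanH) (μ cartanHbar)) (hv0 : v ≠ 0) :
    Nonempty (M ≃ₗ[U] simpleModule μ) := by
  have hne : vermaLift hv ≠ 0 := fun h0 => hv0 (by
    rw [← vermaLift_vermaVec hv, h0, LinearMap.zero_apply])
  have hsurj : Function.Surjective (vermaLift hv) := LinearMap.surjective_of_ne_zero hne
  have hker : vermaRadical μ = LinearMap.ker (vermaLift hv) :=
    le_antisymm (sSup_le fun N hN => le_ker_vermaLift hv hv0 hN)
      (le_sSup fun htop => hne (LinearMap.ker_eq_top.1 htop))
  exact ⟨((Submodule.quotEquivOfEq _ _ hker).trans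
    ((vermaLift hv).quotKerEquivOfSurjective hsurj)).symm⟩

end Verma

/-- For a weight `μ` with `μ(h̄) = 0` and `μ(h) ∉ ℤ`, the module `L(μ)` is the Verma module of
`sl₂`. -/
theorem nonempty_sl2Verma_equiv {μ : Weight} (h0 : μ cartanHbar = 0)
    (hμ : ∀ n : ℤ, μ cartanH ≠ n) :
    Nonempty (sl2Verma (μ cartanH) ≃ₗ[U] simpleModule μ) := by
  have := isSimpleModule_sl2Verma hμ
  refine nonempty_equiv_simpleModule (v := vec _ 1) ?_
    ((map_ne_zero_iff _ (vec _).injective).2 one_ne_zero)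
  rw [h0]
  exact isHighestWeight_vec_one _

/-- Every non-zero module in `𝒪` has a highest weight vector. -/
theorem exists_isHighestWeight {M : GMod} (hM : CatO M) [Nontrivial M] :
    ∃ (v : M) (a b : ℂ), v ≠ 0 ∧ IsHighestWeight v a b := by
  obtain ⟨c, hc⟩ : ∃ c, (op M h).eigenspace c ≠ ⊥ := by
    by_contra! hbot
    exact bot_ne_top (α := Submodule ℂ M) (by rw [← hM.2]; simp [hbot])
  obtain ⟨m, hm, hm0⟩ := (Submodule.ne_bot_iff _).1 hc
  obtain ⟨W, hWfin, hmW, hW⟩ := hM.1.2 m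
  have hb : ∀ x ∈ ({h, hbar, e, ebar} : Set G), ∀ w ∈ W, inc x • w ∈ W := fun x hx =>
    hW x (LieSubalgebra.subset_lieSpan hx)
  let A : ℕ → Submodule ℂ M := fun n => W ⊓ (op M h).eigenspace (c + 2 * n)
  have hA : ∀ n x, x ∈ A n ↔ x ∈ W ∧ inc h • x = (c + 2 * n) • x := fun n x =>
    and_congr_right fun _ => Module.End.mem_eigenspace_iff
  -- As `W` is finite dimensional, not all of the eigenvalues `c + 2 n` can occur on it.
  obtain ⟨n, hn, hn1⟩ : ∃ n, A n ≠ ⊥ ∧ A (n + 1) = ⊥ := by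
    by_contra! hall
    have hne : ∀ n, A n ≠ ⊥ := by
      intro n
      induction n with
      | zero =>
        refine (Submodule.ne_bot_iff _).2 ⟨m, (hA 0 m).2 ⟨hmW, ?_⟩, hm0⟩
        rw [Nat.cast_zero, mul_zero, add_zero]
        exact Module.End.mem_eigenspace_iff.1 hm
      | succ n ih => exact hall n ih
    let T : Module.End ℂ W := (op M h).restrict (hb h (by simp))
    have hT : ∀ n : ℕ, T.HasEigenvalue (c + 2 * n) := by
      intro n
      obtain ⟨x, hx, hx0⟩ := (Submodule.ne_bot_iff _).1 (hne n)
      rw [hA] at hx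
      refine Module.End.hasEigenvalue_of_hasEigenvector (x := ⟨x, hx.1⟩)
        ⟨Module.End.mem_eigenspace_iff.2 (Subtype.ext hx.2), fun h0 => hx0 ?_⟩
      exact congrArg Subtype.val h0
    refine Set.infinite_of_injective_forall_mem (f := fun n : ℕ => c + 2 * (n : ℂ)) ?_ hT
      (Module.End.finite_hasEigenvalue T)
    intro i j hij
    simpa using hij
  have raise : ∀ x ∈ ({h, hbar, e, ebar} : Set G), ⁅h, x⁆ = (2 : ℂ) • x →
      ∀ w ∈ A n, inc x • w = 0 := by
    intro x hx hhx w hw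
    rw [hA] at hw
    have : inc x • w ∈ A (n + 1) := by
      refine (hA _ _).2 ⟨hb x hx w hw.1, ?_⟩
      rw [swap_smul, hhx, hw.2, inc_smulC, smulC_comm]
      generalize inc x • w = y
      push_cast
      module
    rwa [hn1, Submodule.mem_bot] at this
  have hbarA : ∀ w ∈ A n, op M hbar w ∈ A n := by
    intro w hw
    rw [hA] at hw ⊢
    refine ⟨hb hbar (by simp) w hw.1, ?_⟩
    rw [op_apply, swap_smul, lie_h_hbar, hw.2, smulC_comm]
    simp [inc]
  have : Nontrivial (A n) := (Submodule.nontrivial_iff_ne_bot).2 hn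
  have : FiniteDimensional ℂ (A n) := Submodule.finiteDimensional_of_le inf_le_left
  obtain ⟨b, hbv⟩ := Module.End.exists_eigenvalue ((op M hbar).restrict hbarA)
  obtain ⟨⟨v, hv⟩, hvb⟩ := hbv.exists_hasEigenvector
  refine ⟨v, c + 2 * n, b, fun h0 => hvb.2 (Subtype.ext h0), raise e (by simp) lie_h_e v hv,
    raise ebar (by simp) lie_h_ebar v hv, ((hA _ _).1 hv).2, ?_⟩
  exact congrArg Subtype.val (Module.End.mem_eigenspace_iff.1 hvb.1)

/-! ### Membership in `𝒪` -/

theorem catO_of_equiv {M N : GMod} (g : M ≃ₗ[U] N) (hM : CatO M) : CatO N := by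
  have hsub : IsSubquotient N (M.prod M) :=
    ⟨⊤, (g.toLinearMap ∘ₗ LinearMap.fst U M M) ∘ₗ (⊤ : Submodule U (M.prod M)).subtype,
      fun n => ⟨⟨(g.symm n, 0), trivial⟩, g.apply_symm_apply n⟩⟩
  have := hM.1.1
  exact ⟨⟨Module.Finite.equiv g, borelLocallyFinite_of_subquotient hM.1.2 hM.1.2 hsub⟩,
    hDiagonalizable_of_subquotient hM.2 hM.2 hsub⟩

theorem support_of_equiv {M N : GMod} (g : M ≃ₗ[U] N) : support N ⊆ support M := by
  intro μ hμ
  obtain ⟨z, ⟨hz1, hz2⟩, hz0⟩ := (Submodule.ne_bot_iff _).1 hμ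
  exact (Submodule.ne_bot_iff _).2 ⟨g.symm z, ⟨maxGen_map g.symm.toLinearMap _ _ _ hz1,
    maxGen_map g.symm.toLinearMap _ _ _ hz2⟩, (map_ne_zero_iff _ g.symm.injective).2 hz0⟩

theorem mem_degreeLT_iff {n : ℕ} {p : ℂ[X]} :
    p ∈ degreeLT ℂ n ↔ ∀ m, n ≤ m → p.coeff m = 0 := by
  rw [mem_degreeLT, degree_lt_iff_coeff_zero]

theorem self_mem_degreeLT (p : ℂ[X]) : p ∈ degreeLT ℂ (p.natDegree + 1) :=
  mem_degreeLT_iff.2 fun _ hm => coeff_eq_zero_of_natDegree_lt hm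

theorem degreeLT_le {m n : ℕ} (hmn : m ≤ n) : degreeLT ℂ m ≤ degreeLT ℂ n :=
  fun _ hp => mem_degreeLT_iff.2 fun k hk => mem_degreeLT_iff.1 hp k (hmn.trans hk)

theorem opE_mem_degreeLT (c : ℂ) {n : ℕ} {p : ℂ[X]} (hp : p ∈ degreeLT ℂ n) :
    opE c p ∈ degreeLT ℂ n := by
  rw [mem_degreeLT_iff] at hp ⊢
  intro m hm
  rw [opE_coeff, hp _ (by omega), mul_zero]

theorem opH_mem_degreeLT (c : ℂ) {n : ℕ} {p : ℂ[X]} (hp : p ∈ degreeLT ℂ n) :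
    opH c p ∈ degreeLT ℂ n := by
  rw [mem_degreeLT_iff] at hp ⊢
  intro m hm
  rw [opH_coeff, hp _ hm, mul_zero]

instance finiteDimensional_degreeLT (n : ℕ) : FiniteDimensional ℂ (degreeLT ℂ n) :=
  Module.Finite.equiv (degreeLTEquiv ℂ n).symm

theorem catO_sl2Verma (c : ℂ) : CatO (sl2Verma c) := by
  refine ⟨⟨⟨⟨{vec c 1}, by simpa using span_vec_one c⟩⟩, fun m => ?_⟩, ?_⟩
  · obtain ⟨p, rfl⟩ := vec_surj c m
    refine ⟨(degreeLT ℂ (p.natDegree + 1)).map (vec c).toLinearMap, inferInstance,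
      ⟨p, self_mem_degreeLT p, rfl⟩, stable_of_borel_gens _ ?_⟩
    rintro x hx _ ⟨q, hq, rfl⟩
    rcases hx with rfl | rfl | rfl | rfl
    · exact ⟨_, opH_mem_degreeLT c hq, (h_vec c q).symm⟩
    · rw [hbar_sl2Verma]; exact zero_mem _
    · exact ⟨_, opE_mem_degreeLT c hq, (e_vec c q).symm⟩
    · rw [ebar_sl2Verma]; exact zero_mem _
  · rw [HDiagonalizable, eq_top_iff]
    exact fun m _ => vec_mem c (fun n => Submodule.mem_iSup_of_mem (c - 2 * n)
      (Module.End.mem_eigenspace_iff.2 (h_vec_X_pow c n))) m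

/-- An eigenvector of `h` is a monomial. -/
theorem opH_eigen {d s : ℂ} {p : ℂ[X]} (hp : opH d p = C s * p) :
    p = 0 ∨ ∃ (n : ℕ) (t : ℂ), s = d - 2 * n ∧ p = C t * X ^ n := by
  refine or_iff_not_imp_left.2 fun hp0 => ?_
  have hcoeff : ∀ n : ℕ, d - 2 * n = s ∨ p.coeff n = 0 := fun n => by
    have := congrArg (fun q => q.coeff n) hp
    simp only [opH_coeff, coeff_C_mul] at this
    rw [← sub_eq_zero, ← sub_mul, mul_eq_zero, sub_eq_zero] at this
    exact this
  obtain ⟨n, hn⟩ : ∃ n, p.coeff n ≠ 0 := by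
    by_contra! hall
    exact hp0 (Polynomial.ext (by simpa using hall))
  have hs := (hcoeff n).resolve_right hn
  refine ⟨n, p.coeff n, hs.symm, ?_⟩
  ext m
  rw [coeff_C_mul_X_pow]
  split_ifs with hmn
  · rw [hmn]
  · refine (hcoeff m).resolve_left fun hm => hmn ?_
    rw [← hs] at hm
    simpa using hm

theorem support_sl2Verma (c : ℂ) {μ : Weight} (hμ : μ ∈ support (sl2Verma c)) :
    μ cartanHbar = 0 ∧ ∃ n : ℕ, μ cartanH = c - 2 * n := by
  obtain ⟨z, ⟨hz1, hz2⟩, hz0⟩ := (Submodule.ne_bot_iff _).1 hμ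
  constructor
  · obtain ⟨k, hk⟩ := (Module.End.mem_maxGenEigenspace _ _ _).1 hz2
    have h0 : op (sl2Verma c) hbar = 0 := LinearMap.ext (hbar_sl2Verma c)
    rw [h0, zero_sub, ← neg_smul, _root_.smul_pow, one_pow, LinearMap.smul_apply,
      Module.End.one_apply, smul_eq_zero] at hk
    simpa using eq_zero_of_pow_eq_zero (hk.resolve_right hz0)
  · by_contra! hne
    obtain ⟨k, hk⟩ := (Module.End.mem_maxGenEigenspace _ _ _).1 hz1
    obtain ⟨p, rfl⟩ := vec_surj c z
    have hpow : ∀ k n, (((opH c - μ cartanH • 1) ^ k : Module.End ℂ ℂ[X]) p).coeff n =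
        (c - 2 * n - μ cartanH) ^ k * p.coeff n := by
      intro k
      induction k with
      | zero => simp
      | succ k ih =>
        intro n
        rw [pow_succ', Module.End.mul_apply, LinearMap.sub_apply, coeff_sub, opH_coeff, ih]
        simp only [LinearMap.smul_apply, Module.End.one_apply, coeff_smul, ih, smul_eq_mul]
        ring
    have hop : op (sl2Verma c) h = (vec c).conj (opH c) := by
      refine LinearMap.ext fun m => ?_
      obtain ⟨q, rfl⟩ := vec_surj c m
      rw [op_apply, h_vec, LinearEquiv.conj_apply_apply, LinearEquiv.symm_apply_apply]
    have hk' : ((opH c - μ cartanH • 1) ^ k : Module.End ℂ ℂ[X]) p = 0 := by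
      have h1 : (op (sl2Verma c) h - μ cartanH • 1) ^ k =
          (vec c).conj ((opH c - μ cartanH • 1) ^ k) := by
        change _ = (vec c).conjAlgEquiv ℂ _
        rw [map_pow, map_sub, map_smul, map_one]
        congr 2
      rw [h1, LinearEquiv.conj_apply_apply, LinearEquiv.symm_apply_apply] at hk
      exact (vec c).injective (hk.trans (map_zero _).symm)
    refine hz0 ?_
    have : p = 0 := by
      ext n
      have h1 := hpow k n
      rw [hk', coeff_zero, eq_comm, mul_eq_zero] at h1
      exact h1.resolve_left (pow_ne_zero _ (sub_ne_zero.2 (hne n).symm))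
    rw [this, map_zero]

/-! ### Cocycles of extensions -/

namespace Extension

section Cocycle

variable {P : GMod → Prop} {L S : GMod} {X : Extension P L S} {κ : U → L → S}

theorem exists_cocycle_of_section (X : Extension P L S) (s : L →ₗ[ℂ] X.E)
    (hs : ∀ l, X.p (s l) = l) :
    ∃ κ : U → L → S, X.HasCocycle κ ∧ ∀ u l, X.i (κ u l) = u • s l - s (u • l) := by
  have : ∀ u l, ∃ t, X.i t = u • s l - s (u • l) := fun u l =>
    (X.exact (u • s l - s (u • l))).1 (by rw [map_sub, X.p.map_smul, hs, hs, sub_self])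
  choose κ hκ using this
  exact ⟨κ, ⟨s, hs, hκ⟩, hκ⟩

theorem HasCocycle.mul (hκ : X.HasCocycle κ) (u v : U) (l : L) :
    κ (u * v) l = u • κ v l + κ u (v • l) := by
  obtain ⟨s, -, hs⟩ := hκ
  refine X.inj ?_
  rw [map_add, map_smul, hs, hs, hs, smul_sub, mul_smul, mul_smul]
  abel

theorem HasCocycle.add (hκ : X.HasCocycle κ) (u v : U) (l : L) :
    κ (u + v) l = κ u l + κ v l := by
  obtain ⟨s, -, hs⟩ := hκ
  refine X.inj ?_
  rw [map_add, hs, hs, hs, add_smul, add_smul, map_add]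
  abel

theorem HasCocycle.smul (hκ : X.HasCocycle κ) (a : ℂ) (u : U) (l : L) :
    κ (a • u) l = a • κ u l := by
  obtain ⟨s, -, hs⟩ := hκ
  refine X.inj ?_
  rw [map_smulC, hs, hs, smul_assoc, smul_assoc, map_smul, smul_sub]

theorem HasCocycle.scalar (hκ : X.HasCocycle κ) (a : ℂ) (l : L) :
    κ (algebraMap ℂ U a) l = 0 := by
  obtain ⟨s, -, hs⟩ := hκ
  refine X.inj ?_
  rw [map_zero, hs, algebraMap_smul, algebraMap_smul, map_smul, sub_self]

/-- A cocycle as a linear map in its second argument. -/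
theorem HasCocycle.exists_linear (hκ : X.HasCocycle κ) (u : U) :
    ∃ τ : L →ₗ[ℂ] S, ∀ l, τ l = κ u l := by
  obtain ⟨s, -, hs⟩ := hκ
  refine ⟨{ toFun := κ u, map_add' := fun a b => X.inj ?_, map_smul' := fun a b => X.inj ?_ },
    fun _ => rfl⟩
  · rw [map_add, hs, hs, hs, map_add, smul_add, smul_add, map_add]
    abel
  · rw [RingHom.id_apply, map_smulC, hs, hs, map_smul, smulC_comm, smulC_comm, map_smul, smul_sub]

theorem HasCocycle.zero_right (hκ : X.HasCocycle κ) (u : U) : κ u 0 = 0 := by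
  obtain ⟨τ, hτ⟩ := hκ.exists_linear u
  rw [← hτ, map_zero]

theorem HasCocycle.lie (hκ : X.HasCocycle κ) (x y : G) (l : L) :
    κ (inc ⁅x, y⁆) l =
      inc x • κ (inc y) l + κ (inc x) (inc y • l) - (inc y • κ (inc x) l + κ (inc y) (inc x • l)) := by
  have h1 : inc x * inc y = inc y * inc x + inc ⁅x, y⁆ := by
    simpa using swap_smul (M := U) x y 1
  have h2 := hκ.mul (inc x) (inc y) l
  rw [h1, hκ.add, hκ.mul] at h2
  rw [← h2]
  abel

theorem HasCocycle.eq_zero (hκ : X.HasCocycle κ)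
    (h0 : ∀ x ∈ ({e, h, f, ebar, hbar, fbar} : Set G), ∀ l, κ (inc x) l = 0) : κ = 0 := by
  funext u
  induction u using U_induction with
  | hC a => exact funext fun l => hκ.scalar a l
  | hadd u v hu hv => exact funext fun l => by rw [hκ.add, hu, hv]; simp
  | hmul u v hu hv => exact funext fun l => by rw [hκ.mul, hu, hv]; simp
  | hG x =>
    induction mem_span_basis x using Submodule.span_induction with
    | mem x hx => exact funext (h0 x hx)
    | zero =>
      funext l
      simpa [inc] using hκ.scalar 0 l
    | add x y _ _ hx hy =>
      funext l
      rw [inc, map_add, hκ.add]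
      exact (congrArg₂ (· + ·) (congrFun hx l) (congrFun hy l)).trans (add_zero _)
    | smul a x _ hx =>
      funext l
      rw [inc, map_smul, hκ.smul]
      exact (congrArg (a • ·) (congrFun hx l)).trans (smul_zero _)

end Cocycle

/-- A cocycle that vanishes on `sl₂`, so that the underlying section is `sl₂`-equivariant. -/
structure IsNormalized {L S : GMod} (κ : U → L → S) : Prop where
  e : ∀ l, κ (inc e) l = 0
  h : ∀ l, κ (inc h) l = 0
  f : ∀ l, κ (inc f) l = 0

section Normalized

variable {P : GMod → Prop} {c : ℂ} {S : GMod} {E : Extension P (sl2Verma c) S}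
  {κ : U → sl2Verma c → S}

theorem HasCocycle.hbar_one (hκ : E.HasCocycle κ) (hn : IsNormalized κ) :
    κ (inc hbar) (vec c 1) = inc Takiff.e • κ (inc fbar) (vec c 1) := by
  have := hκ.lie Takiff.e fbar (vec c 1)
  rwa [lie_e_fbar, hn.e, hn.e, e_vec_one, hκ.zero_right, smul_zero, add_zero, add_zero,
    sub_zero] at this

theorem HasCocycle.ebar_one (hκ : E.HasCocycle κ) (hn : IsNormalized κ) :
    (-2 : ℂ) • κ (inc ebar) (vec c 1) = inc Takiff.e • κ (inc hbar) (vec c 1) := by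
  have := hκ.lie Takiff.e hbar (vec c 1)
  rwa [lie_e_hbar, hn.e, hn.e, e_vec_one, hκ.zero_right, smul_zero, add_zero, add_zero,
    sub_zero, inc, map_smul, hκ.smul] at this

theorem HasCocycle.e_ebar_one (hκ : E.HasCocycle κ) (hn : IsNormalized κ) :
    inc Takiff.e • κ (inc ebar) (vec c 1) = 0 := by
  have := hκ.lie Takiff.e ebar (vec c 1)
  rw [lie_e_ebar, hn.e, hn.e, e_vec_one, hκ.zero_right, smul_zero, add_zero, add_zero,
    sub_zero, inc, map_zero] at this
  rw [← this]
  simpa using hκ.scalar 0 (vec c 1)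

theorem HasCocycle.h_fbar_one (hκ : E.HasCocycle κ) (hn : IsNormalized κ) :
    inc Takiff.h • κ (inc fbar) (vec c 1) = (c - 2) • κ (inc fbar) (vec c 1) := by
  have := hκ.lie Takiff.h fbar (vec c 1)
  obtain ⟨τ, hτ⟩ := hκ.exists_linear (inc fbar)
  rw [lie_h_fbar, hn.h, hn.h, h_vec_one, smul_zero, add_zero, zero_add,
    inc, map_smul, hκ.smul, ← hτ, ← hτ, map_smul, eq_sub_iff_add_eq] at this
  rw [← hτ, ← this]
  module

theorem HasCocycle.e_e_e_fbar_one (hκ : E.HasCocycle κ) (hn : IsNormalized κ) :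
    inc Takiff.e • inc Takiff.e • inc Takiff.e • κ (inc fbar) (vec c 1) = 0 := by
  rw [← hκ.hbar_one hn, ← hκ.ebar_one hn, smulC_comm, hκ.e_ebar_one hn, smul_zero]

/-- A normalized cocycle is determined by its value at `f̄` and the highest weight vector. -/
theorem HasCocycle.eq_zero_of_normalized (hκ : E.HasCocycle κ) (hn : IsNormalized κ)
    (h0 : κ (inc fbar) (vec c 1) = 0) : κ = 0 := by
  have hh := hκ.hbar_one hn
  rw [h0, smul_zero] at hh
  have he := hκ.ebar_one hn
  rw [hh, smul_zero, smul_eq_zero] at he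
  replace he := he.resolve_left (by norm_num)
  have step : ∀ (y : G) (l : sl2Verma c),
      κ (inc y) (inc Takiff.f • l) = κ (inc ⁅y, Takiff.f⁆) l + inc Takiff.f • κ (inc y) l := by
    intro y l
    rw [hκ.lie, hn.f, hn.f, smul_zero]
    abel
  have key : ∀ n : ℕ, κ (inc ebar) (vec c (X ^ n)) = 0 ∧ κ (inc hbar) (vec c (X ^ n)) = 0 ∧
      κ (inc fbar) (vec c (X ^ n)) = 0 := by
    intro n
    induction n with
    | zero => exact ⟨by simpa using he, by simpa using hh, by simpa using h0⟩
    | succ n ih =>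
      obtain ⟨ih1, ih2, ih3⟩ := ih
      have hz : κ (inc (0 : G)) (vec c (X ^ n)) = 0 := by
        rw [inc, map_zero]
        simpa using hκ.scalar 0 (vec c (X ^ n))
      have hf : κ (inc ((-2 : ℂ) • fbar)) (vec c (X ^ n)) = 0 := by
        rw [inc, map_smul, hκ.smul, ih3, smul_zero]
      rw [pow_succ', ← f_vec, step, step, step, lie_ebar_f, lie_hbar_f, lie_fbar_f, ih1, ih2, ih3,
        hz, hf]
      simp
  have all : ∀ x : G, (∀ n, κ (inc x) (vec c (X ^ n)) = 0) → ∀ l, κ (inc x) l = 0 := by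
    intro x hx l
    obtain ⟨τ, hτ⟩ := hκ.exists_linear (inc x)
    have : l ∈ LinearMap.ker τ := vec_mem c (fun n => by
      rw [LinearMap.mem_ker, hτ]; exact hx n) l
    rw [← hτ]
    exact this
  refine hκ.eq_zero ?_
  rintro x (rfl | rfl | rfl | rfl | rfl | rfl)
  · exact hn.e
  · exact hn.h
  · exact hn.f
  · exact all _ fun n => (key n).1
  · exact all _ fun n => (key n).2.1
  · exact all _ fun n => (key n).2.2

end Normalized

end Extension

/-- Weight vectors lift along surjections from modules on which `h` is diagonalizable. -/
theorem exists_eigen_lift {M N : GMod} (hM : HDiagonalizable M) (g : M →ₗ[U] N)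
    (hg : Function.Surjective g) {n : N} {a : ℂ} (hn : inc h • n = a • n) :
    ∃ m, inc h • m = a • m ∧ g m = n := by
  classical
  obtain ⟨m, rfl⟩ := hg n
  obtain ⟨s, hs⟩ := (mem_iSup_eigenspace_iff (op M h) m).1 (by
    rw [HDiagonalizable] at hM; rw [hM]; trivial)
  have haev : ∀ (q : ℂ[X]) (m : M), aeval (op M h) q m = aeval (inc h) q • m := fun q m => by
    rw [op, aeval_algHom_apply]; rfl
  rw [haev] at hs
  set q : ℂ[X] := ∏ c ∈ s.erase a, (X - C c) with hq
  have hqa : q.eval a ≠ 0 := by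
    rw [hq, eval_prod, Finset.prod_ne_zero_iff]
    intro b hb
    simpa [sub_eq_zero] using (Finset.ne_of_mem_erase hb).symm
  have h1 : aeval (inc h) ((X - C a) * q) • m = 0 := by
    by_cases ha : a ∈ s
    · rwa [hq, Finset.mul_prod_erase s (fun c => X - C c) ha]
    · rw [hq, Finset.erase_eq_of_notMem ha, map_mul, mul_smul, hs, smul_zero]
  refine ⟨(q.eval a)⁻¹ • aeval (inc h) q • m, ?_, ?_⟩
  · rw [map_mul, mul_smul, map_sub, aeval_X, aeval_C, sub_smul, algebraMap_smul, sub_eq_zero] at h1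
    rw [smulC_comm, h1, smul_comm]
  · rw [Extension.map_smulC, map_smul, aeval_smul_of_eigen hn, smul_smul, inv_mul_cancel₀ hqa,
      one_smul]

theorem e_lowered {M : Type*} [AddCommGroup M] [Module ℂ M] [Module U M] [IsScalarTower ℂ U M]
    {v : M} {a : ℂ} (he : inc e • v = 0) (hh : inc h • v = a • v) (n : ℕ) :
    inc e • lowered v (n + 1, 0) = ((n + 1) * (a - n)) • lowered v (n, 0) := by
  induction n with
  | zero =>
    rw [← f_lowered, swap_smul, lie_e_f, h_lowered hh]
    simp only [lowered, pow_zero, one_smul, he, smul_zero]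
    push_cast
    module
  | succ n ih =>
    rw [← f_lowered, swap_smul, lie_e_f, h_lowered hh, ih, smulC_comm, f_lowered]
    push_cast
    module

namespace Extension

/-- In an extension of Verma modules of `sl₂` on which `h` is diagonalizable, the highest weight
vector of the quotient lifts to a vector that is killed by `e`, because `e` is surjective on the
submodule; hence the extension splits over `sl₂`. -/
theorem exists_normalized {P : GMod → Prop} {c d : ℂ} (hd : ∀ n : ℤ, d ≠ n)
    (X : Extension P (sl2Verma c) (sl2Verma d)) (hX : HDiagonalizable X.E) :
    ∃ κ, X.HasCocycle κ ∧ IsNormalized κ := by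
  obtain ⟨w, hw, hpw⟩ := exists_eigen_lift hX X.p X.surj (h_vec_one c)
  obtain ⟨y, hy⟩ := (X.exact (inc Takiff.e • w)).1 (by rw [map_smul, hpw, e_vec_one])
  obtain ⟨q, rfl⟩ := vec_surj d y
  have hhq : inc Takiff.h • vec d q = (c + 2) • vec d q := X.inj (by
    rw [map_smul, map_smulC, hy, swap_smul, lie_h_e, hw, inc_smulC, smulC_comm]
    generalize inc Takiff.e • w = z
    module)
  obtain ⟨z, hez, hhz⟩ : ∃ z : sl2Verma d, inc Takiff.e • z = vec d q ∧ inc Takiff.h • z = c • z := by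
    rw [h_vec, ← vec_C_mul] at hhq
    rcases opH_eigen ((vec d).injective hhq) with rfl | ⟨n, t, hs, rfl⟩
    · exact ⟨0, by simp, by simp⟩
    · refine ⟨(t * ((n + 1) * (d - n))⁻¹) • vec d (Polynomial.X ^ (n + 1)), ?_, ?_⟩
      · rw [smulC_comm, e_vec_X_pow_succ, smul_smul, mul_assoc,
          inv_mul_cancel₀ (lowering_ne_zero hd n), mul_one, vec_C_mul]
      · have : d - 2 * ((n + 1 : ℕ) : ℂ) = c := by
          push_cast
          linear_combination -hs
        rw [smulC_comm, h_vec_X_pow, this, smul_comm]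
  obtain ⟨v, hev, hhv, hpv⟩ : ∃ v : X.E, inc Takiff.e • v = 0 ∧ inc Takiff.h • v = c • v ∧
      X.p v = vec c 1 := by
    refine ⟨w - X.i z, ?_, ?_, ?_⟩
    · rw [smul_sub, ← map_smul, hez, hy, sub_self]
    · rw [smul_sub, ← map_smul, hhz, hw, map_smulC, smul_sub]
    · rw [map_sub, p_i, sub_zero, hpw]
  let s : sl2Verma c →ₗ[ℂ] X.E :=
    { toFun := fun m => aeval (inc Takiff.f) ((vec c).symm m) • v
      map_add' := fun a b => by rw [map_add, map_add, add_smul]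
      map_smul' := fun a b => by rw [map_smul, map_smul, smul_assoc, RingHom.id_apply] }
  have hs : ∀ n : ℕ, s (vec c (Polynomial.X ^ n)) = lowered v (n, 0) := fun n => by
    change aeval (inc Takiff.f) ((vec c).symm (vec c (Polynomial.X ^ n))) • v = _
    rw [LinearEquiv.symm_apply_apply, aeval_X_pow, lowered, pow_zero, one_smul]
  have hps : ∀ l, X.p (s l) = l := fun l => by
    have : l ∈ LinearMap.ker (toC X.p ∘ₗ s - LinearMap.id) := vec_mem c (fun n => by
      rw [LinearMap.mem_ker, LinearMap.sub_apply, LinearMap.comp_apply, hs, sub_eq_zero]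
      change X.p (lowered v (n, 0)) = _
      rw [lowered, pow_zero, one_smul, map_smul, hpv, f_pow_vec_one]; rfl) l
    exact sub_eq_zero.1 this
  obtain ⟨κ, hκ, hκ'⟩ := X.exists_cocycle_of_section s hps
  have zero : ∀ x : G, (∀ n : ℕ, inc x • s (vec c (Polynomial.X ^ n)) =
      s (inc x • vec c (Polynomial.X ^ n))) → ∀ l, κ (inc x) l = 0 := by
    intro x hx l
    have : l ∈ LinearMap.ker (op X.E x ∘ₗ s - s ∘ₗ op (sl2Verma c) x) := vec_mem c (fun n => by
      rw [LinearMap.mem_ker, LinearMap.sub_apply, sub_eq_zero]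
      exact hx n) l
    exact X.inj (by rw [hκ', map_zero]; exact this)
  refine ⟨κ, hκ, zero _ fun n => ?_, zero _ fun n => ?_, zero _ fun n => ?_⟩
  · cases n with
    | zero =>
      rw [hs, pow_zero, e_vec_one, map_zero]
      simpa [lowered, -UniversalEnvelopingAlgebra.ι_apply] using hev
    | succ n => rw [hs, e_vec_X_pow_succ, map_smul, hs, e_lowered hev hhv]
  · rw [hs, h_vec_X_pow, map_smul, hs, h_lowered hhv, Nat.cast_zero, add_zero]
  · rw [hs, f_lowered, f_vec, ← pow_succ', hs]

end Extension

/-! ### Extensions of Verma modules of `sl₂` -/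

/-- An `sl₂`-equivariant map `sl₂ ⊗ ℂ[X] → ℂ[X]`, from the tensor product of the adjoint
representation with the Verma module of highest weight `c` to the Verma module of highest weight
`d`, given by the images `E`, `H`, `F` of the standard basis of `sl₂` in `End ℂ[X]`. The last two
fields bound the degrees of the polynomials in the image. -/
structure Intertwiner (c d : ℂ) where
  /-- The image of `e`. -/
  E : Module.End ℂ ℂ[X]
  /-- The image of `h`. -/
  H : Module.End ℂ ℂ[X]
  /-- The image of `f`. -/
  F : Module.End ℂ ℂ[X]
  ee : ∀ p, opE d (E p) = E (opE c p)
  eh : ∀ p, opE d (H p) = H (opE c p) - (2 : ℂ) • E p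
  ef : ∀ p, opE d (F p) = F (opE c p) + H p
  he : ∀ p, opH d (E p) = E (opH c p) + (2 : ℂ) • E p
  hh : ∀ p, opH d (H p) = H (opH c p)
  hf : ∀ p, opH d (F p) = F (opH c p) - (2 : ℂ) • F p
  fe : ∀ p, opF (E p) = E (opF p) - H p
  fh : ∀ p, opF (H p) = H (opF p) + (2 : ℂ) • F p
  ff : ∀ p, opF (F p) = F (opF p)
  degE : ∀ n, ∀ p ∈ degreeLT ℂ n, E p ∈ degreeLT ℂ (n + 1)
  degH : ∀ n, ∀ p ∈ degreeLT ℂ n, H p ∈ degreeLT ℂ (n + 1)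

namespace Intertwiner

variable {c d : ℂ} (T : Intertwiner c d)

/-- The operator `(s, l) ↦ (τ l, 0)`. -/
def offDiag (τ : Module.End ℂ ℂ[X]) : Module.End ℂ (ℂ[X] × ℂ[X]) :=
  LinearMap.inl ℂ _ _ ∘ₗ τ ∘ₗ LinearMap.snd ℂ _ _

theorem offDiag_apply (τ : Module.End ℂ ℂ[X]) (x : ℂ[X] × ℂ[X]) : offDiag τ x = (τ x.2, 0) := rfl

theorem tripleMap_offDiag (E H F : Module.End ℂ ℂ[X]) (x : Sl2) :
    tripleMap (offDiag E) (offDiag H) (offDiag F) x = offDiag (tripleMap E H F x) := by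
  apply LinearMap.ext
  intro y
  simp [tripleMap, offDiag_apply]

theorem adjointTriple_diag : AdjointTriple
    ((opE d).prodMap (opE c)) ((opH d).prodMap (opH c)) (opF.prodMap opF)
    ((opE d).prodMap (opE c)) ((opH d).prodMap (opH c)) (opF.prodMap opF) := by
  have h1 := adjointTriple_self d
  have h2 := adjointTriple_self c
  constructor <;> apply LinearMap.ext <;> rintro ⟨p, q⟩ <;> refine Prod.ext ?_ ?_
  exacts [LinearMap.congr_fun h1.ee p, LinearMap.congr_fun h2.ee q,
    LinearMap.congr_fun h1.eh p, LinearMap.congr_fun h2.eh q,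
    LinearMap.congr_fun h1.ef p, LinearMap.congr_fun h2.ef q,
    LinearMap.congr_fun h1.he p, LinearMap.congr_fun h2.he q,
    LinearMap.congr_fun h1.hh p, LinearMap.congr_fun h2.hh q,
    LinearMap.congr_fun h1.hf p, LinearMap.congr_fun h2.hf q,
    LinearMap.congr_fun h1.fe p, LinearMap.congr_fun h2.fe q,
    LinearMap.congr_fun h1.fh p, LinearMap.congr_fun h2.fh q,
    LinearMap.congr_fun h1.ff p, LinearMap.congr_fun h2.ff q]

theorem adjointTriple_offDiag : AdjointTriple
    ((opE d).prodMap (opE c)) ((opH d).prodMap (opH c)) (opF.prodMap opF)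
    (offDiag T.E) (offDiag T.H) (offDiag T.F) := by
  constructor <;> apply LinearMap.ext <;> rintro ⟨p, q⟩ <;> refine Prod.ext ?_ ?_
  exacts [T.ee q, by simp [offDiag_apply], T.eh q, by simp [offDiag_apply],
    T.ef q, by simp [offDiag_apply], T.he q, by simp [offDiag_apply],
    T.hh q, by simp [offDiag_apply], T.hf q, by simp [offDiag_apply],
    T.fe q, by simp [offDiag_apply], T.fh q, by simp [offDiag_apply],
    T.ff q, by simp [offDiag_apply]]

/-- The action of `U(𝔤)` on `ℂ[X] ⊕ ℂ[X]` in which `sl₂` acts diagonally and `sl₂ ⊗ x` maps the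
second summand to the first one through the intertwiner. -/
def rep : U →ₐ[ℂ] Module.End ℂ (ℂ[X] × ℂ[X]) :=
  liftTakiff
    (tripleMap ((opE d).prodMap (opE c)) ((opH d).prodMap (opH c)) (opF.prodMap opF))
    (tripleMap (offDiag T.E) (offDiag T.H) (offDiag T.F))
    adjointTriple_diag.lie T.adjointTriple_offDiag.lie fun x y => by
      rw [tripleMap_offDiag, tripleMap_offDiag]
      apply LinearMap.ext
      intro z
      simp [offDiag_apply]

/-- The middle term of the extension given by an intertwiner. -/
def mid : GMod := GMod.ofRep (ℂ[X] × ℂ[X]) T.rep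

/-- The vector of the middle term given by a pair of polynomials. -/
def pair : (ℂ[X] × ℂ[X]) ≃ₗ[ℂ] T.mid := LinearEquiv.refl ℂ _

theorem e_pair (p q : ℂ[X]) : inc e • T.pair (p, q) = T.pair (opE d p, opE c q) := by
  change T.rep (inc e) (p, q) = _
  rw [rep, e, liftTakiff_one, tripleMap_E]; rfl

theorem h_pair (p q : ℂ[X]) : inc h • T.pair (p, q) = T.pair (opH d p, opH c q) := by
  change T.rep (inc h) (p, q) = _
  rw [rep, h, liftTakiff_one, tripleMap_H]; rfl

theorem f_pair (p q : ℂ[X]) : inc f • T.pair (p, q) = T.pair (X * p, X * q) := by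
  change T.rep (inc f) (p, q) = _
  rw [rep, f, liftTakiff_one, tripleMap_F]; rfl

theorem ebar_pair (p q : ℂ[X]) : inc ebar • T.pair (p, q) = T.pair (T.E q, 0) := by
  change T.rep (inc ebar) (p, q) = _
  rw [rep, ebar, liftTakiff_eps, tripleMap_E]; rfl

theorem hbar_pair (p q : ℂ[X]) : inc hbar • T.pair (p, q) = T.pair (T.H q, 0) := by
  change T.rep (inc hbar) (p, q) = _
  rw [rep, hbar, liftTakiff_eps, tripleMap_H]; rfl

theorem fbar_pair (p q : ℂ[X]) : inc fbar • T.pair (p, q) = T.pair (T.F q, 0) := by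
  change T.rep (inc fbar) (p, q) = _
  rw [rep, fbar, liftTakiff_eps, tripleMap_F]; rfl

end Intertwiner

/-- A `ℂ`-linear map of `𝔤`-modules that commutes with the basis of `𝔤` is `U(𝔤)`-linear. -/
def homOfBasis {M N : GMod} (g : M →ₗ[ℂ] N)
    (hg : ∀ x ∈ ({e, h, f, ebar, hbar, fbar} : Set G), ∀ m, g (inc x • m) = inc x • g m) :
    M →ₗ[U] N where
  toFun := g
  map_add' := map_add g
  map_smul' u m := by
    -- The graph of `g` is stable under the basis of `𝔤`.
    let W : Submodule ℂ (M × N) := LinearMap.graph g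
    have hW := stable_of_basis W (by
      rintro x hx ⟨a, b⟩ hab
      rw [LinearMap.mem_graph_iff] at hab ⊢
      change inc x • b = g (inc x • a)
      rw [hg x hx, ← hab]) u (m, g m) rfl
    exact ((LinearMap.mem_graph_iff g _).1 hW).symm

namespace Intertwiner

variable {c d : ℂ} (T : Intertwiner c d)

/-- The inclusion of the submodule. -/
def incl : sl2Verma d →ₗ[U] T.mid :=
  homOfBasis (T.pair.toLinearMap ∘ₗ LinearMap.inl ℂ _ _ ∘ₗ (vec d).symm.toLinearMap) (by
    have key : ∀ p, (T.pair.toLinearMap ∘ₗ LinearMap.inl ℂ _ _ ∘ₗ (vec d).symm.toLinearMap)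
        (vec d p) = T.pair (p, 0) := fun p => rfl
    intro x hx m
    obtain ⟨p, rfl⟩ := vec_surj d m
    rcases hx with rfl | rfl | rfl | rfl | rfl | rfl
    · rw [e_vec, key, key, e_pair, map_zero]
    · rw [h_vec, key, key, h_pair, map_zero]
    · rw [f_vec, key, key, f_pair, mul_zero]
    · rw [ebar_sl2Verma, map_zero, key, ebar_pair, map_zero]; rfl
    · rw [hbar_sl2Verma, map_zero, key, hbar_pair, map_zero]; rfl
    · rw [fbar_sl2Verma, map_zero, key, fbar_pair, map_zero]; rfl)

theorem incl_vec (p : ℂ[X]) : T.incl (vec d p) = T.pair (p, 0) := rfl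

/-- The projection to the quotient. -/
def proj : T.mid →ₗ[U] sl2Verma c :=
  homOfBasis ((vec c).toLinearMap ∘ₗ LinearMap.snd ℂ _ _ ∘ₗ T.pair.symm.toLinearMap) (by
    have key : ∀ p q, ((vec c).toLinearMap ∘ₗ LinearMap.snd ℂ _ _ ∘ₗ T.pair.symm.toLinearMap)
        (T.pair (p, q)) = vec c q := fun p q => rfl
    intro x hx m
    obtain ⟨⟨p, q⟩, rfl⟩ := T.pair.surjective m
    rcases hx with rfl | rfl | rfl | rfl | rfl | rfl
    · rw [e_pair, key, key, e_vec]
    · rw [h_pair, key, key, h_vec]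
    · rw [f_pair, key, key, f_vec]
    · rw [ebar_pair, key, key, ebar_sl2Verma, map_zero]
    · rw [hbar_pair, key, key, hbar_sl2Verma, map_zero]
    · rw [fbar_pair, key, key, fbar_sl2Verma, map_zero])

theorem proj_pair (p q : ℂ[X]) : T.proj (T.pair (p, q)) = vec c q := rfl

theorem incl_injective : Function.Injective T.incl := by
  intro a b hab
  obtain ⟨p, rfl⟩ := vec_surj d a
  obtain ⟨q, rfl⟩ := vec_surj d b
  rw [incl_vec, incl_vec] at hab
  exact congrArg (fun x => vec d x.1) (T.pair.injective hab)

theorem proj_surjective : Function.Surjective T.proj := fun a => by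
  obtain ⟨p, rfl⟩ := vec_surj c a
  exact ⟨T.pair (0, p), T.proj_pair 0 p⟩

theorem exact : Function.Exact T.incl T.proj := by
  intro m
  obtain ⟨⟨p, q⟩, rfl⟩ := T.pair.surjective m
  rw [proj_pair]
  constructor
  · intro hq
    obtain rfl : q = 0 := (vec c).injective (hq.trans (map_zero _).symm)
    exact ⟨vec d p, rfl⟩
  · rintro ⟨a, ha⟩
    obtain ⟨p', rfl⟩ := vec_surj d a
    rw [incl_vec] at ha
    exact (congrArg (fun x => vec c x.2) (T.pair.injective ha)).symm.trans (map_zero _)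

theorem catO_mid : CatO T.mid := by
  refine ⟨⟨finite_of_exact T.incl T.proj T.proj_surjective T.exact (catO_sl2Verma d).1.1
    (catO_sl2Verma c).1.1, fun m => ?_⟩, ?_⟩
  · obtain ⟨⟨p, q⟩, rfl⟩ := T.pair.surjective m
    -- `ē` and `h̄` raise the degree by at most one, and their image lies in the first summand.
    set n := max (p.natDegree + 1) (q.natDegree + 1) with hn
    have hfin : FiniteDimensional ℂ ((degreeLT ℂ (n + 1)).prod (degreeLT ℂ n)) :=
      Module.Finite.iff_fg.2 ((Module.Finite.iff_fg.1 (finiteDimensional_degreeLT (n + 1))).prod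
        (Module.Finite.iff_fg.1 (finiteDimensional_degreeLT n)))
    refine ⟨((degreeLT ℂ (n + 1)).prod (degreeLT ℂ n)).map T.pair.toLinearMap, inferInstance,
      ⟨(p, q), ⟨degreeLT_le (by omega) (self_mem_degreeLT p),
        degreeLT_le (by omega) (self_mem_degreeLT q)⟩, rfl⟩, stable_of_borel_gens _ ?_⟩
    rintro x hx _ ⟨⟨a, b⟩, ⟨ha, hb⟩, rfl⟩
    rcases hx with rfl | rfl | rfl | rfl
    · exact ⟨_, ⟨opH_mem_degreeLT d ha, opH_mem_degreeLT c hb⟩, (T.h_pair a b).symm⟩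
    · exact ⟨_, ⟨T.degH n b hb, zero_mem _⟩, (T.hbar_pair a b).symm⟩
    · exact ⟨_, ⟨opE_mem_degreeLT d ha, opE_mem_degreeLT c hb⟩, (T.e_pair a b).symm⟩
    · exact ⟨_, ⟨T.degE n b hb, zero_mem _⟩, (T.ebar_pair a b).symm⟩
  · rw [HDiagonalizable, eq_top_iff]
    rintro m -
    obtain ⟨⟨p, q⟩, rfl⟩ := T.pair.surjective m
    have h1 := vec_mem d (W := (⨆ a : ℂ, (op T.mid h).eigenspace a).comap (Extension.toC T.incl))
      (fun n => Submodule.mem_iSup_of_mem (d - 2 * n) (Module.End.mem_eigenspace_iff.2 (by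
        change inc h • T.pair (X ^ n, 0) = _ • T.pair (X ^ n, 0)
        rw [h_pair, opH_X_pow, map_zero, ← map_smul, Prod.smul_mk, smul_zero, smul_eq_C_mul])))
      (vec d p)
    have h2 := vec_mem c (W := (⨆ a : ℂ, (op T.mid h).eigenspace a).comap
        (T.pair.toLinearMap ∘ₗ LinearMap.inr ℂ _ _ ∘ₗ (vec c).symm.toLinearMap))
      (fun n => Submodule.mem_iSup_of_mem (c - 2 * n) (Module.End.mem_eigenspace_iff.2 (by
        change inc h • T.pair (0, X ^ n) = _ • T.pair (0, X ^ n)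
        rw [h_pair, opH_X_pow, map_zero, ← map_smul, Prod.smul_mk, smul_zero, smul_eq_C_mul])))
      (vec c q)
    have h3 : T.pair (p, q) = T.pair (p, 0) + T.pair (0, q) := by
      rw [← map_add, Prod.mk_add_mk, add_zero, zero_add]
    rw [h3]
    exact add_mem h1 h2

/-- The extension given by an intertwiner. -/
def extension {P : GMod → Prop} (hP : P T.mid) : Extension P (sl2Verma c) (sl2Verma d) where
  E := T.mid
  i := T.incl
  p := T.proj
  inj := T.incl_injective
  surj := T.proj_surjective
  exact := T.exact
  mem := hP

theorem exists_cocycle {P : GMod → Prop} (hP : P T.mid) :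
    ∃ κ, (T.extension hP).HasCocycle κ ∧ Extension.IsNormalized κ ∧
      ∀ p, κ (inc fbar) (vec c p) = vec d (T.F p) := by
  obtain ⟨κ, hκ, hκ'⟩ := (T.extension hP).exists_cocycle_of_section
    (T.pair.toLinearMap ∘ₗ LinearMap.inr ℂ _ _ ∘ₗ (vec c).symm.toLinearMap) fun l => rfl
  have hs : ∀ u p, T.incl (κ u (vec c p)) = u • T.pair (0, p) -
      (T.pair.toLinearMap ∘ₗ LinearMap.inr ℂ _ _ ∘ₗ (vec c).symm.toLinearMap) (u • vec c p) :=
    fun u p => hκ' u (vec c p)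
  have hs' : ∀ q, (T.pair.toLinearMap ∘ₗ LinearMap.inr ℂ _ _ ∘ₗ (vec c).symm.toLinearMap)
      (vec c q) = T.pair (0, q) := fun q => rfl
  refine ⟨κ, hκ, ⟨fun l => ?_, fun l => ?_, fun l => ?_⟩, fun p => T.incl_injective ?_⟩
  · obtain ⟨p, rfl⟩ := vec_surj c l
    refine T.incl_injective ?_
    rw [hs, e_vec, hs', e_pair, map_zero, map_zero, sub_self]
  · obtain ⟨p, rfl⟩ := vec_surj c l
    refine T.incl_injective ?_
    rw [hs, h_vec, hs', h_pair, map_zero, map_zero, sub_self]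
  · obtain ⟨p, rfl⟩ := vec_surj c l
    refine T.incl_injective ?_
    rw [hs, f_vec, hs', f_pair, mul_zero, map_zero, sub_self]
  · rw [hs, fbar_sl2Verma, map_zero, sub_zero, fbar_pair, incl_vec]

end Intertwiner

/-- The intertwiner for the highest weights `c` and `c - 2`. Here and in the other two cases `F` is
the multiplication by `X ^ n`, which commutes with `f`, and the other two operators are forced:
`H = [e, F]` and `-2 E = [e, H]`. -/
def intertwinerDown (c : ℂ) : Intertwiner c (c - 2) where
  E := -(derivative ∘ₗ derivative)
  H := -((2 : ℂ) • derivative)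
  F := LinearMap.id
  ee p := by
    simp [opE_apply, C_two]
    ring
  eh p := by
    simp [opE_apply, C_two, smul_eq_C_mul]
    ring
  ef p := by
    simp [opE_apply, C_two, smul_eq_C_mul]
    ring
  he p := by
    simp [opH_apply, C_two, smul_eq_C_mul]
    ring
  hh p := by
    simp [opH_apply, C_two, smul_eq_C_mul]
    ring
  hf p := by
    simp [opH_apply, C_two, smul_eq_C_mul]
    ring
  fe p := by
    simp [opF_apply, C_two, smul_eq_C_mul]
    ring
  fh p := by
    simp [opF_apply, C_two, smul_eq_C_mul]
    ring
  ff p := rfl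
  degE n p hp := mem_degreeLT_iff.2 fun k hk => by
    simp [coeff_derivative, mem_degreeLT_iff.1 hp (k + 1 + 1) (by omega)]
  degH n p hp := mem_degreeLT_iff.2 fun k hk => by
    simp [coeff_derivative, mem_degreeLT_iff.1 hp (k + 1) (by omega)]

/-- The intertwiner for a self-extension: `x ⊗ p ↦ x p`. -/
def intertwinerLoop (c : ℂ) : Intertwiner c c where
  E := opE c
  H := opH c
  F := opF
  ee _ := rfl
  eh p := LinearMap.congr_fun (adjointTriple_self c).eh p
  ef p := LinearMap.congr_fun (adjointTriple_self c).ef p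
  he p := LinearMap.congr_fun (adjointTriple_self c).he p
  hh _ := rfl
  hf p := LinearMap.congr_fun (adjointTriple_self c).hf p
  fe p := LinearMap.congr_fun (adjointTriple_self c).fe p
  fh p := LinearMap.congr_fun (adjointTriple_self c).fh p
  ff _ := rfl
  degE n _ hp := degreeLT_le n.le_succ (opE_mem_degreeLT c hp)
  degH n _ hp := degreeLT_le n.le_succ (opH_mem_degreeLT c hp)

/-- The intertwiner for the highest weights `c` and `c + 2`. -/
def intertwinerUp (c : ℂ) : Intertwiner c (c + 2) where
  E := -(((c + 1) * (c + 2)) • LinearMap.id - (2 * (c + 1)) • LinearMap.mulLeft ℂ X ∘ₗ derivative +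
    LinearMap.mulLeft ℂ (X ^ 2) ∘ₗ derivative ∘ₗ derivative)
  H := (2 * (c + 1)) • LinearMap.mulLeft ℂ X - (2 : ℂ) • LinearMap.mulLeft ℂ (X ^ 2) ∘ₗ derivative
  F := LinearMap.mulLeft ℂ (X ^ 2)
  ee p := by
    simp [opE_apply, C_two, smul_eq_C_mul]
    ring
  eh p := by
    simp [opE_apply, C_two, smul_eq_C_mul]
    ring
  ef p := by
    simp [opE_apply, C_two, smul_eq_C_mul]
    ring
  he p := by
    simp [opH_apply, C_two, smul_eq_C_mul]
    ring
  hh p := by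
    simp [opH_apply, C_two, smul_eq_C_mul]
    ring
  hf p := by
    simp [opH_apply, C_two, smul_eq_C_mul]
    ring
  fe p := by
    simp [opF_apply, C_two, smul_eq_C_mul]
    ring
  fh p := by
    simp [opF_apply, C_two, smul_eq_C_mul]
    ring
  ff p := by
    simp [opF_apply]
    ring
  degE n p hp := mem_degreeLT_iff.2 fun k hk => by
    rcases k with _ | _ | k
    · omega
    · simp [coeff_derivative, mem_degreeLT_iff.1 hp 1 (by omega), pow_two]
    · simp [coeff_derivative, mem_degreeLT_iff.1 hp (k + 1 + 1) (by omega), coeff_X_pow_mul]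
  degH n p hp := mem_degreeLT_iff.2 fun k hk => by
    rcases k with _ | _ | k
    · omega
    · simp [coeff_derivative, mem_degreeLT_iff.1 hp 0 (by omega), pow_two]
    · simp [coeff_derivative, mem_degreeLT_iff.1 hp (k + 1) (by omega), coeff_X_pow_mul]

/-! ### Dimensions of extension spaces -/

section Rank

variable {P : GMod → Prop} {c d : ℂ}

open Extension

theorem exists_normalized_rep (hd : ∀ n : ℤ, d ≠ n) (hPO : ∀ M, P M → CatO M)
    {hL : P (sl2Verma c)} {hS : P (sl2Verma d)} (x : Ext1 P ⟨sl2Verma c, hL⟩ ⟨sl2Verma d, hS⟩) :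
    ∃ (X : Extension P (sl2Verma c) (sl2Verma d)) (κ : U → sl2Verma c → sl2Verma d),
      x = Ext1.mk X ∧ X.HasCocycle κ ∧ IsNormalized κ := by
  obtain ⟨X, rfl⟩ := Quotient.exists_rep x
  obtain ⟨κ, hκ, hn⟩ := exists_normalized hd X (hPO _ X.mem).2
  exact ⟨X, κ, rfl, hκ, hn⟩

/-- The value of a normalized cocycle at `f̄` and the highest weight vector has weight `c - 2` and
is killed by `e³`. Hence it is a multiple of `X ^ n` with `n ≤ 2`. -/
theorem normalized_fbar_one (hd : ∀ n : ℤ, d ≠ n) {X : Extension P (sl2Verma c) (sl2Verma d)}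
    {κ : U → sl2Verma c → sl2Verma d} (hκ : X.HasCocycle κ) (hn : IsNormalized κ) :
    κ (inc fbar) (vec c 1) = 0 ∨ ∃ (n : ℕ) (t : ℂ), n ≤ 2 ∧ d = c - 2 + 2 * n ∧
      κ (inc fbar) (vec c 1) = t • vec d (Polynomial.X ^ n) := by
  have hw := hκ.h_fbar_one hn
  have h3 := hκ.e_e_e_fbar_one hn
  obtain ⟨q, hq⟩ := vec_surj d (κ (inc fbar) (vec c 1))
  rw [← hq] at hw h3 ⊢
  rw [h_vec, ← vec_C_mul] at hw
  rcases opH_eigen ((vec d).injective hw) with rfl | ⟨n, t, hs, rfl⟩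
  · exact Or.inl (map_zero _)
  by_cases hn2 : n ≤ 2
  · exact Or.inr ⟨n, t, hn2, by linear_combination -hs, vec_C_mul _ _ _⟩
  · obtain ⟨m, rfl⟩ : ∃ m, n = m + 1 + 1 + 1 := ⟨n - 3, by omega⟩
    simp only [vec_C_mul, smulC_comm, e_vec_X_pow_succ] at h3
    have ht : t = 0 := by
      have hX : vec d (Polynomial.X ^ m) ≠ 0 :=
        (map_ne_zero_iff _ (vec d).injective).2 (pow_ne_zero _ X_ne_zero)
      simpa only [smul_eq_zero, lowering_ne_zero hd, hX, or_false] using h3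
    exact Or.inl (by rw [ht, C_0, zero_mul, map_zero])

variable [ExtAdmissible P] {hL : P (sl2Verma c)} {hS : P (sl2Verma d)}

theorem rank_ext_eq_zero (hPO : ∀ M, P M → CatO M) (hd : ∀ n : ℤ, d ≠ n) (hcd : ∀ n : ℕ, n ≤ 2 → d ≠ c - 2 + 2 * n) :
    Module.rank ℂ (Ext1 P ⟨sl2Verma c, hL⟩ ⟨sl2Verma d, hS⟩) = 0 := by
  have hzero : ∀ x : Ext1 P ⟨sl2Verma c, hL⟩ ⟨sl2Verma d, hS⟩, x = 0 := by
    intro x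
    obtain ⟨X, κ, rfl, hκ, hn⟩ := exists_normalized_rep hd hPO x
    rcases normalized_fbar_one hd hκ hn with h0 | ⟨n, t, hn2, hdn, -⟩
    · obtain rfl := hκ.eq_zero_of_normalized hn h0
      exact Ext1.mk_eq_of_cocycle hκ (hasCocycle_split hL hS)
    · exact absurd hdn (hcd n hn2)
  have : Subsingleton (Ext1 P ⟨sl2Verma c, hL⟩ ⟨sl2Verma d, hS⟩) :=
    ⟨fun x y => (hzero x).trans (hzero y).symm⟩
  exact rank_subsingleton' ..

theorem exists_intertwiner {n : ℕ} (hn : n ≤ 2) (hdn : d = c - 2 + 2 * n) :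
    ∃ T : Intertwiner c d, T.F 1 = Polynomial.X ^ n := by
  interval_cases n
  · obtain rfl : d = c - 2 := by rw [hdn]; simp
    exact ⟨intertwinerDown c, by simp [intertwinerDown]⟩
  · obtain rfl : d = c := by rw [hdn]; simp
    exact ⟨intertwinerLoop d, by simp [intertwinerLoop, opF_apply]⟩
  · obtain rfl : d = c + 2 := by rw [hdn]; push_cast; ring
    exact ⟨intertwinerUp c, by simp [intertwinerUp]⟩

theorem rank_ext_eq_one (hPO : ∀ M, P M → CatO M) (hT : ∀ T : Intertwiner c d, P T.mid)
    (hd : ∀ n : ℤ, d ≠ n) {n : ℕ} (hn : n ≤ 2) (hdn : d = c - 2 + 2 * n) :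
    Module.rank ℂ (Ext1 P ⟨sl2Verma c, hL⟩ ⟨sl2Verma d, hS⟩) = 1 := by
  obtain ⟨T, hTF⟩ := exists_intertwiner hn hdn
  replace hT := hT T
  obtain ⟨κ₀, hκ₀, hn₀, hF⟩ := T.exists_cocycle hT
  have hF1 := hF 1
  rw [hTF] at hF1
  have hX : vec d (Polynomial.X ^ n) ≠ 0 :=
    (map_ne_zero_iff _ (vec d).injective).2 (pow_ne_zero _ X_ne_zero)
  refine rank_eq_one_iff.2 ⟨Ext1.mk (T.extension hT), fun h0 => ?_, fun x => ?_⟩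
  · -- A coboundary vanishes at `f̄`, which acts by zero on both Verma modules.
    obtain ⟨τ, hτ⟩ := (hκ₀.of_equivalent (Ext1.mk_eq_mk.1 h0)).sub_mem (hasCocycle_split hL hS)
    have h1 := congrFun (congrFun hτ (inc fbar)) (vec c 1)
    rw [sub_zero, hF1] at h1
    refine hX (h1.symm.trans ?_)
    change inc fbar • τ (vec c 1) - τ (inc fbar • vec c 1) = 0
    rw [fbar_sl2Verma, fbar_sl2Verma, map_zero, sub_zero]
  · obtain ⟨X, κ, rfl, hκ, hn⟩ := exists_normalized_rep hd hPO x
    obtain ⟨t, ht⟩ : ∃ t : ℂ, κ (inc fbar) (vec c 1) = t • vec d (Polynomial.X ^ n) := by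
      rcases normalized_fbar_one hd hκ hn with h0 | ⟨m, t, -, hdm, ht⟩
      · exact ⟨0, by rw [h0, zero_smul]⟩
      · have : m = n := by
          have : (2 : ℂ) * m = 2 * n := by linear_combination hdn - hdm
          exact_mod_cast mul_left_cancel₀ two_ne_zero this
        exact ⟨t, by rw [ht, this]⟩
    refine ⟨t, (sub_eq_zero.1 ?_).symm⟩
    have hdiff := hκ.baer hL hS (hκ₀.scale hL hS (-t))
    have hdn : IsNormalized (κ + (-t) • κ₀) := by
      constructor <;> intro l <;> change κ _ l + (-t) • κ₀ _ l = 0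
      · rw [hn.e, hn₀.e, smul_zero, add_zero]
      · rw [hn.h, hn₀.h, smul_zero, add_zero]
      · rw [hn.f, hn₀.f, smul_zero, add_zero]
    have hz := hdiff.eq_zero_of_normalized hdn (by
      change κ _ _ + (-t) • κ₀ _ _ = 0
      rw [ht, hF1, neg_smul, add_neg_cancel])
    rw [hz] at hdiff
    rw [sub_eq_add_neg, ← neg_smul, Ext1.smul_mk, Ext1.mk_add]
    exact Ext1.mk_eq_of_cocycle hdiff (hasCocycle_split hL hS)

end Rank

/-! ### The block of `λ` -/

section Block

variable {lam : Weight}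

theorem weight_h (lam : Weight) (k : ℤ) :
    (lam + k • alpha) cartanH = lam cartanH + 2 * k := by
  rw [LinearMap.add_apply, LinearMap.smul_apply, alpha_h, zsmul_eq_mul, mul_comm]

theorem weight_hbar (h0 : lam cartanHbar = 0) (k : ℤ) : (lam + k • alpha) cartanHbar = 0 := by
  rw [LinearMap.add_apply, LinearMap.smul_apply, alpha_hbar, h0, smul_zero, add_zero]

theorem weight_not_int (hint : ∀ n : ℤ, lam cartanH ≠ n) (k n : ℤ) :
    lam cartanH + 2 * k ≠ n := fun hn => hint (n - 2 * k) (by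
  push_cast
  linear_combination hn)

theorem weight_ext {μ ν : Weight} (h1 : μ cartanH = ν cartanH)
    (h2 : μ cartanHbar = ν cartanHbar) : μ = ν := by
  refine LinearMap.ext fun ⟨x, hx⟩ => ?_
  have hx' := hx
  rw [mem_cartan_iff] at hx'
  obtain ⟨s, t, rfl⟩ := hx'
  have h3 : (⟨s • h + t • hbar, hx⟩ : cartan) = s • cartanH + t • cartanHbar := rfl
  rw [h3, map_add, map_add, map_smul, map_smul, map_smul, map_smul, h1, h2]

theorem nonempty_equiv_weight (h0 : lam cartanHbar = 0) (hint : ∀ n : ℤ, lam cartanH ≠ n)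
    (k : ℤ) :
    Nonempty (sl2Verma (lam cartanH + 2 * k) ≃ₗ[U] simpleModule (lam + k • alpha)) := by
  have := nonempty_sl2Verma_equiv (weight_hbar h0 k) (fun n => by
    rw [weight_h]; exact weight_not_int hint k n)
  rwa [weight_h] at this

theorem blockO_sl2Verma (h0 : lam cartanHbar = 0)
    (k : ℤ) : BlockO (rootCoset lam) (sl2Verma (lam cartanH + 2 * k)) := by
  refine ⟨catO_sl2Verma _, fun μ hμ => ?_⟩
  obtain ⟨h1, n, hn⟩ := support_sl2Verma _ hμ
  refine ⟨k - n, weight_ext ?_ ?_⟩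
  · rw [weight_h, hn]
    push_cast
    ring
  · rw [h1, weight_hbar h0]

theorem blockO_simpleModule (h0 : lam cartanHbar = 0) (hint : ∀ n : ℤ, lam cartanH ≠ n)
    (k : ℤ) :
    BlockO (rootCoset lam) (simpleModule (lam + k • alpha)) := by
  obtain ⟨g⟩ := nonempty_equiv_weight h0 hint k
  have hB := blockO_sl2Verma h0 k
  exact ⟨catO_of_equiv g hB.1, (support_of_equiv g).trans hB.2⟩

theorem isSimpleModule_simpleModule (h0 : lam cartanHbar = 0) (hint : ∀ n : ℤ, lam cartanH ≠ n)
    (k : ℤ) :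
    IsSimpleModule U (simpleModule (lam + k • alpha)) := by
  obtain ⟨g⟩ := nonempty_equiv_weight h0 hint k
  have := isSimpleModule_sl2Verma (weight_not_int hint k)
  exact IsSimpleModule.congr g.symm

/-- The simple objects of the block: the weight of a highest weight vector lies in the support. -/
theorem exists_equiv_simpleModule {M : GMod} (hM : BlockO (rootCoset lam) M)
    (hs : IsSimpleModule U M) : ∃ k : ℤ, Nonempty (M ≃ₗ[U] simpleModule (lam + k • alpha)) := by
  have := IsSimpleModule.nontrivial U M
  obtain ⟨v, a, b, hv0, hv⟩ := exists_isHighestWeight hM.1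
  obtain ⟨μ, rfl, rfl⟩ := exists_weight a b
  have hμ : μ ∈ support M := by
    refine (Submodule.ne_bot_iff _).2 ⟨v, ⟨?_, ?_⟩, hv0⟩
    · refine (Module.End.mem_maxGenEigenspace _ _ _).2 ⟨1, ?_⟩
      rw [pow_one, LinearMap.sub_apply, op_apply, hv.h]
      exact sub_self _
    · refine (Module.End.mem_maxGenEigenspace _ _ _).2 ⟨1, ?_⟩
      rw [pow_one, LinearMap.sub_apply, op_apply, hv.hbar]
      exact sub_self _
  obtain ⟨k, hk⟩ := hM.2 hμ
  exact ⟨k, hk ▸ nonempty_equiv_simpleModule hv hv0⟩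

theorem eq_of_simpleModule_equiv (h0 : lam cartanHbar = 0) (hint : ∀ n : ℤ, lam cartanH ≠ n)
    {k l : ℤ}
    (g : Nonempty (simpleModule (lam + k • alpha) ≃ₗ[U] simpleModule (lam + l • alpha))) :
    k = l := by
  obtain ⟨g⟩ := g
  obtain ⟨g₁⟩ := nonempty_equiv_weight h0 hint k
  obtain ⟨g₂⟩ := nonempty_equiv_weight h0 hint l
  have := eq_of_sl2Verma_equiv (weight_not_int hint l) ((g₁.trans g).trans g₂.symm)
  have h2 : (2 : ℂ) * k = 2 * l := by linear_combination this
  exact_mod_cast mul_left_cancel₀ two_ne_zero h2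

/-- The dimensions of the extension spaces, in any full subcategory of `𝒪` that contains the
extensions in `𝒪` of its objects. -/
theorem rank_ext_simpleModule (h0 : lam cartanHbar = 0) (hint : ∀ n : ℤ, lam cartanH ≠ n)
    {P : GMod → Prop} [ExtAdmissible P] (hPO : ∀ M, P M → CatO M)
    (hext : ∀ {S E L : GMod} (i : S →ₗ[U] E) (p : E →ₗ[U] L), Function.Injective i →
      Function.Exact i p → P S → P L → CatO E → P E)
    (hV : ∀ k : ℤ, P (sl2Verma (lam cartanH + 2 * k))) (k l : ℤ)
    (hk : P (simpleModule (lam + k • alpha))) (hl : P (simpleModule (lam + l • alpha))) :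
    Module.rank ℂ (Ext1 P ⟨_, hk⟩ ⟨_, hl⟩) =
      if l = k ∨ l = k + 1 ∨ l = k - 1 then 1 else 0 := by
  obtain ⟨g₁⟩ := nonempty_equiv_weight h0 hint k
  obtain ⟨g₂⟩ := nonempty_equiv_weight h0 hint l
  have hcongr := (Ext1.congr (P := P) (L := ⟨_, hV k⟩) (S := ⟨_, hV l⟩) (L' := ⟨_, hk⟩)
    (S' := ⟨_, hl⟩) g₁ g₂).rank_eq
  rw [← hcongr]
  have hd := weight_not_int hint l
  have hT : ∀ T : Intertwiner (lam cartanH + 2 * k) (lam cartanH + 2 * l), P T.mid := fun T =>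
    hext T.incl T.proj T.incl_injective T.exact (hV l) (hV k) T.catO_mid
  split_ifs with hkl
  · obtain ⟨n, hn, hl⟩ : ∃ n : ℕ, n ≤ 2 ∧ l = k - 1 + n := by
      rcases hkl with h | h | h
      exacts [⟨1, by omega, by omega⟩, ⟨2, by omega, by omega⟩, ⟨0, by omega, by omega⟩]
    refine rank_ext_eq_one hPO hT hd hn ?_
    rw [hl]
    push_cast
    ring
  · refine rank_ext_eq_zero hPO hd fun n _ hne => hkl ?_
    have h1 : (l : ℂ) = k - 1 + n := by linear_combination hne / 2
    have h2 : l = k - 1 + n := by exact_mod_cast h1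
    omega

end Block

end Takiff

end

theorem corollary23 (lam : Takiff.Weight)
    (hbar_zero : lam Takiff.cartanHbar = 0)
    (h_not_int : ∀ n : ℤ, lam Takiff.cartanH ≠ (n : ℂ)) :
    (∃ φ : ℤ ≃ Takiff.Vertex (Takiff.BlockO (Takiff.rootCoset lam)),
      (∀ k : ℤ, ∃ (hO : Takiff.BlockO (Takiff.rootCoset lam)
            (Takiff.simpleModule (lam + k • Takiff.alpha)))
          (hs : IsSimpleModule Takiff.U (Takiff.simpleModule (lam + k • Takiff.alpha))),
        φ k = Takiff.Vertex.mk (Takiff.simpleModule (lam + k • Takiff.alpha)) hO hs) ∧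
      ∀ k l : ℤ, Cardinal.mk (φ k ⟶ φ l) =
        if l = k ∨ l = k + 1 ∨ l = k - 1 then 1 else 0) ∧
    ∃ hO : ∀ μ ∈ Takiff.rootCoset lam, Takiff.CatO (Takiff.simpleModule μ),
      ∀ (μ : Takiff.Weight) (hμ : μ ∈ Takiff.rootCoset lam),
        ((μ = lam ∨ μ = lam + Takiff.alpha ∨ μ = lam - Takiff.alpha) →
          Module.rank ℂ (Takiff.Ext1 Takiff.CatO ⟨Takiff.simpleModule lam, hO lam (Takiff.self_mem_rootCoset lam)⟩
            ⟨Takiff.simpleModule μ, hO μ hμ⟩) = 1) ∧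
        (¬ (μ = lam ∨ μ = lam + Takiff.alpha ∨ μ = lam - Takiff.alpha) →
          Module.rank ℂ (Takiff.Ext1 Takiff.CatO ⟨Takiff.simpleModule lam, hO lam (Takiff.self_mem_rootCoset lam)⟩
            ⟨Takiff.simpleModule μ, hO μ hμ⟩) = 0) := by
  have hB := Takiff.blockO_simpleModule hbar_zero h_not_int
  have hS := Takiff.isSimpleModule_simpleModule hbar_zero h_not_int
  constructor
  · let φ : ℤ → Takiff.Vertex (Takiff.BlockO (Takiff.rootCoset lam)) := fun k =>
      Takiff.Vertex.mk (Takiff.simpleModule (lam + k • Takiff.alpha)) (hB k) (hS k)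
    have hφ : Function.Bijective φ := by
      constructor
      · intro k l hkl
        exact Takiff.eq_of_simpleModule_equiv hbar_zero h_not_int (Quotient.exact hkl)
      · intro v
        obtain ⟨⟨⟨M, hM⟩, hs⟩, rfl⟩ := Quotient.exists_rep v
        obtain ⟨k, ⟨g⟩⟩ := Takiff.exists_equiv_simpleModule hM hs
        exact ⟨k, Quotient.sound ⟨g.symm⟩⟩
    refine ⟨Equiv.ofBijective φ hφ, fun k => ⟨hB k, hS k, rfl⟩, fun k l => ?_⟩
    refine (Cardinal.mk_out _).trans ?_
    exact Takiff.rank_ext_simpleModule hbar_zero h_not_int (fun M hM => hM.1)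
      (fun i p hi hip hS hL hE => ⟨hE, (Takiff.support_of_exact i p hi hip).trans
        (Set.union_subset hS.2 hL.2)⟩)
      (Takiff.blockO_sl2Verma hbar_zero) k l (hB k) (hB l)
  · have hO : ∀ μ ∈ Takiff.rootCoset lam, Takiff.CatO (Takiff.simpleModule μ) := by
      rintro _ ⟨k, rfl⟩
      exact (hB k).1
    have hrank : ∀ (ν : Takiff.Weight) (hν : Takiff.CatO (Takiff.simpleModule ν)) (l : ℤ)
        (hl : Takiff.CatO (Takiff.simpleModule (lam + l • Takiff.alpha))),
        ν = lam + (0 : ℤ) • Takiff.alpha →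
        Module.rank ℂ (Takiff.Ext1 Takiff.CatO ⟨Takiff.simpleModule ν, hν⟩ ⟨_, hl⟩) =
          if l = 0 ∨ l = 0 + 1 ∨ l = 0 - 1 then 1 else 0 := by
      rintro _ hν l hl rfl
      exact Takiff.rank_ext_simpleModule hbar_zero h_not_int (fun M hM => hM)
        (fun _ _ _ _ _ _ hE => hE) (fun k => Takiff.catO_sl2Verma _) 0 l hν hl
    have hinj : ∀ k l : ℤ, lam + k • Takiff.alpha = lam + l • Takiff.alpha → k = l :=
      fun k l hkl => Takiff.eq_of_simpleModule_equiv hbar_zero h_not_int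
        (by rw [hkl]; exact ⟨LinearEquiv.refl _ _⟩)
    refine ⟨hO, ?_⟩
    rintro _ ⟨l, rfl⟩
    have hr := hrank lam (hO lam (Takiff.self_mem_rootCoset lam)) l (hO _ ⟨l, rfl⟩) (by simp)
    have hiff : (lam + l • Takiff.alpha = lam ∨ lam + l • Takiff.alpha = lam + Takiff.alpha ∨
        lam + l • Takiff.alpha = lam - Takiff.alpha) ↔ (l = 0 ∨ l = 0 + 1 ∨ l = 0 - 1) := by
      refine or_congr ⟨fun hl => hinj _ _ (by rw [hl]; simp), by rintro rfl; simp⟩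
        (or_congr ⟨fun hl => hinj _ _ (by rw [hl]; simp), by rintro rfl; simp⟩
          ⟨fun hl => hinj _ _ (by rw [hl]; simp [sub_eq_add_neg]),
            by rintro rfl; simp [sub_eq_add_neg]⟩)
    rw [hiff]
    exact ⟨fun hl => by rw [hr, if_pos hl], fun hl => by rw [hr, if_neg hl]⟩
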